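/- Let $n\ge 1$, $p\ge 2$, $\rho\in[0,1]$, let $E=\binom{[n]}{2}$ and let $\mathcal S_n$ be the set of permutations of $[n]$; for $\sigma\in\mathcal S_n$ let $\bar\sigma$ be the permutation $\{u,v\}\mapsto\{\sigma(u),\sigma(v)\}$ of $E$. Let $\pi^\star=(\pi^\star_1,\dots,\pi^\star_p)$ be uniform on $\mathcal S_n^p$, let $H=(H_e)_{e\in E}$ and $Z_j=(Z_{je})_{e\in E}$, $j\in[p]$, have i.i.d. $\mathcal N(0,1)$ entries, all of these being independent, and observe the weighted graphs $G_1,\dots,G_p$ on $[n]$ with $$G_{je}=\sqrt{\rho}\,H_{\bar\pi^\star_j(e)}+\sqrt{1-\rho}\,Z_{je},\qquad j\in[p],\ e\in E.$$ For $\pi\in\mathcal S_n^p$ put $$\mathrm{err}(\pi,\pi^\star)=\min_{\psi\in\mathcal S_n}\frac1{np}\sum_{u=1}^n\sum_{j=1}^p\mathbf 1\{\psi(\pi_j(u))\ne\pi^\star_j(u)\}.$$ A maximum likelihood estimator (MLE) of weighted graphs $g_1,\dots,g_q$ on $[n]$ is any maximizer over $\sigma\in\mathcal S_n^q$ of $\sum_{e\in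 E}\bigl(\sum_{j\le q}g_{j,\bar\sigma_j^{-1}(e)}\bigr)^2$. Let $C>0$ and let $p'$ be an integer with $1\le p'\le p$ and $|p'-C/\rho|<1$ (that is, $C/\rho$ rounded up or down). A two-stage estimator is any measurable $\hat\pi=\hat\pi(G_1,\dots,G_p)\in\mathcal S_n^p$ such that 1. $(\hat\pi_1,\dots,\hat\pi_{p'})$ is an MLE of $(G_1,\dots,G_{p'})$; 2. for every $j>p'$, $(\mathrm{id},\hat\pi_j)$ is an MLE of the two graphs $(\hat G',G_j)$, where $\hat G'_e=\frac1{p'}\sum_{i\le p'}G_{i,\bar{\hat\pi}_i^{-1}(e)}$. **Theorem.** For every $C>0$ there exist constants $c_1,c_2>0$ and $n_0$, depending only on $C$, such that whenever $n\ge n_0$, $p>C/\rho$ and $$\rho\ \ge\ c_1\Bigl(\frac{\log n}{n}\vee\sqrt{\frac{\log n}{np}}\Bigr),$$ every two-stage estimator satisfies $$\mathbb E[\mathrm{err}(\hat\pi,\pi^\star)]\le\exp(-c_2\,n\rho).$$ Consequently partial recovery is possible in this regime: for any sequences $p=p_n$, $\rho=\rho_n$ satisfying these conditions for all $n\ge n_0$,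 there are measurable estimators $\hat\pi^{(n)}$, which are two-stage estimators for all $n\ge n_0$, with $\mathbb E[\mathrm{err}(\hat\pi^{(n)},\pi^\star)]\to0$ as $n\to\infty$. -/

import Mathlib

open MeasureTheory ProbabilityTheory Filter Topology

noncomputable section

namespace GraphAlignment

/-- The edge set of the complete graph on `n` nodes: unordered pairs of distinct nodes. -/
abbrev Edge (n : ℕ) : Type := {e : Sym2 (Fin n) // ¬ e.IsDiag}

/-- Permutations of the `n` nodes. -/
abbrev NodePerm (n : ℕ) : Type := Equiv.Perm (Fin n)

/-- The finite set of permutations carries the discrete sigma-algebra. -/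
instance instMeasurableSpaceNodePerm (n : ℕ) : MeasurableSpace (NodePerm n) := ⊤

instance instDiscreteNodePerm (n : ℕ) : DiscreteMeasurableSpace (NodePerm n) :=
  ⟨fun _ => MeasurableSpace.measurableSet_top⟩

/-- The edge permutation `{u, v} ↦ {σ u, σ v}` induced by a node permutation `σ`. -/
def edgePerm {n : ℕ} (σ : NodePerm n) : Equiv.Perm (Edge n) where
  toFun e := ⟨e.1.map σ, fun h => e.2 ((Sym2.isDiag_map σ.injective).1 h)⟩
  invFun e := ⟨e.1.map σ.symm, fun h => e.2 ((Sym2.isDiag_map σ.symm.injective).1 h)⟩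
  left_inv e := Subtype.ext (by simp [Sym2.map_map])
  right_inv e := Subtype.ext (by simp [Sym2.map_map])

/-- A weighted graph on `n` nodes: one real weight per edge. -/
abbrev WGraph (n : ℕ) : Type := Edge n → ℝ

/-! ### The model -/

/-- The law of a weighted graph with i.i.d. standard Gaussian edge weights. -/
def gaussianGraph (n : ℕ) : Measure (WGraph n) :=
  Measure.pi fun _ => gaussianReal 0 1

/-- The law of `(π⋆, H₀, Z)`: independent, with `π⋆` uniform on the `p`-tuples of permutations,
`H₀` a standard Gaussian graph, and `Z₁, …, Z_p` i.i.d. copies of `H₀`. -/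
def latentLaw (n p : ℕ) :
    Measure ((Fin p → NodePerm n) × WGraph n × (Fin p → WGraph n)) :=
  (uniformOn Set.univ).prod ((gaussianGraph n).prod (Measure.pi fun _ => gaussianGraph n))

/-- The observed graphs `G_{je} = √ρ H₀(Π⋆_j(e)) + √(1 - ρ) Z_{je}`. -/
def observed {n p : ℕ} (ρ : ℝ)
    (ω : (Fin p → NodePerm n) × WGraph n × (Fin p → WGraph n)) : Fin p → WGraph n :=
  fun j e => √ρ * ω.2.1 (edgePerm (ω.1 j) e) + √(1 - ρ) * ω.2.2 j e

/-- The proportion of misclassified points, up to a global relabelling `ψ`. -/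
def err {n p : ℕ} (π πs : Fin p → NodePerm n) : ℝ :=
  ⨅ ψ : NodePerm n,
    1 / ((n : ℝ) * p) * ∑ u : Fin n, ∑ j : Fin p, if ψ (π j u) ≠ πs j u then 1 else 0

/-- The expected error `E[err(π̂(G), π⋆)]` of an estimator `est`. -/
def expectedErr {n p : ℕ} (ρ : ℝ) (est : (Fin p → WGraph n) → (Fin p → NodePerm n)) : ℝ :=
  ∫ ω, err (est (observed ρ ω)) ω.1 ∂(latentLaw n p)

/-- A sequence of estimators achieves partial recovery if its expected error tends to zero as the
number of nodes tends to infinity. -/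
def PartialRecovery (p : ℕ → ℕ) (ρ : ℕ → ℝ)
    (est : ∀ n, (Fin (p n) → WGraph n) → (Fin (p n) → NodePerm n)) : Prop :=
  (∀ n, Measurable (est n)) ∧ Tendsto (fun n => expectedErr (ρ n) (est n)) atTop (𝓝 0)

/-! ### The estimator -/

/-- The likelihood score `Gᵀ Π (J_p ⊗ I_N) Πᵀ G` of a tuple `π` of permutations, where
`(Πᵀ G)_{je} = G_{j, Π_j⁻¹(e)}` and `J_p` is the all-ones matrix. -/
def score {n p : ℕ} (g : Fin p → WGraph n) (π : Fin p → NodePerm n) : ℝ :=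
  ∑ e : Edge n, (∑ j : Fin p, g j ((edgePerm (π j)).symm e)) ^ 2

/-- `π` is a maximum likelihood estimator for the graphs `g`: it maximizes the score. -/
def IsMLE {n p : ℕ} (g : Fin p → WGraph n) (π : Fin p → NodePerm n) : Prop :=
  ∀ σ : Fin p → NodePerm n, score g σ ≤ score g π

/-- The averaged graph `e ↦ (1 / p) ∑_j G_{j, Π_j⁻¹(e)}`. -/
def averageGraph {n p : ℕ} (g : Fin p → WGraph n) (π : Fin p → NodePerm n) : WGraph n :=
  fun e => 1 / (p : ℝ) * ∑ j : Fin p, g j ((edgePerm (π j)).symm e)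

/-- `π` is an output of the two-stage procedure on the graphs `g`: the MLE is run on the first `p'`
graphs, and each remaining graph is aligned by the two-graph MLE to the average of the first `p'`
graphs, relabelled according to the first stage. The average already carries the common
labelling, so its own permutation is the identity. -/
structure IsTwoStageOutput {n p p' : ℕ} (hp : p' ≤ p) (g : Fin p → WGraph n)
    (π : Fin p → NodePerm n) : Prop where
  first : IsMLE (fun j : Fin p' => g (Fin.castLE hp j)) (fun j : Fin p' => π (Fin.castLE hp j))
  rest : ∀ j : Fin p, p' ≤ (j : ℕ) →
    IsMLE ![averageGraph (fun i : Fin p' => g (Fin.castLE hp i))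
        (fun i : Fin p' => π (Fin.castLE hp i)), g j]
      ![1, π j]

/-- `est` is a two-stage estimator whose first stage uses `p'` graphs, where `p' ≥ 1` is `C / ρ`
rounded up or down to an integer; ties between maximizers are broken in any measurable way. -/
structure IsTwoStageEstimator {n p : ℕ} (C ρ : ℝ) (p' : ℕ)
    (est : (Fin p → WGraph n) → (Fin p → NodePerm n)) : Prop where
  measurable : Measurable est
  pos : 1 ≤ p'
  round : |(p' : ℝ) - C / ρ| < 1
  output : ∃ hp : p' ≤ p, ∀ g, IsTwoStageOutput hp g (est g)

/-- The signal strength, the number of graphs and the correlation are in the regime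
`ρ ≥ c₁ (log n / n ∨ √(log n / (n p)))` and `p > C / ρ`. -/
def InRegime (C c₁ : ℝ) (n p : ℕ) (ρ : ℝ) : Prop :=
  2 ≤ p ∧ 0 ≤ ρ ∧ ρ ≤ 1 ∧
    c₁ * max (Real.log n / n) √(Real.log n / ((n : ℝ) * p)) ≤ ρ ∧ C / ρ < p

end GraphAlignment

end

noncomputable section

namespace GraphAlignment

open Matrix

/-! After undoing the planted relabelling, the observations form a Gaussian vector with covariance
`ρ J + (1 - ρ) I`, where `J` links copies of the same edge in different graphs. A competing tuple
`ν` changes the score by a quadratic form in this vector. If `D` counts the edge disagreements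
within `ν`, the form has mean `-ρ D` and its matrix has squared Frobenius norm `2 D`, so a Chernoff
bound (`measure_quadratic_nonneg_le`, `measure_score_le`) makes the competitor win with probability
at most `exp(-ρ² D / (32 k²))`, with `k` a bound on the covariance norm.

Since `D` is at least `n / 4` times the sum of pairwise Hamming distances, each misplaced node costs
a factor `nodeBound`. With `q ≈ C / ρ` graphs, `ρ q` and `k` are of constant order, and this factor
is `exp(-c n ρ)`. It beats the entropy of order `log n` per node, so a union bound weighted by the
number of misplaced nodes handles the first stage (`measure_jointFailure_le`).

If the first stage is right up to a global relabelling, aligning a further graph to the average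
maximizes the score of `q + 1` graphs over the last permutation alone, and the same estimate applies
(`measure_lastFailure_le`). As `err` averages over graphs, no union over the `p` graphs is needed.
-/

/-! ### Exponential moments and tails of Gaussian quadratic forms -/

/-- The integral is exactly `(1 - 2l)^(-1/2)`; a first-order expansion of the logarithm, with
remainder at most `8 l²`, gives the bound. -/
theorem exp_mul_sq_gaussianReal {l : ℝ} (hl : |l| ≤ 1 / 4) :
    Integrable (fun x => Real.exp (l * x ^ 2)) (gaussianReal 0 1) ∧
      ∫ x, Real.exp (l * x ^ 2) ∂(gaussianReal 0 1) ≤ Real.exp (l + 4 * l ^ 2) := by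
  have hl' := abs_le.1 hl
  have hb : 0 < 1 / 2 - l := by linarith
  have key : ∀ x : ℝ, gaussianPDFReal 0 1 x • Real.exp (l * x ^ 2) =
      (√(2 * Real.pi))⁻¹ * Real.exp (-(1 / 2 - l) * x ^ 2) := by
    intro x
    simp only [gaussianPDFReal, NNReal.coe_one, mul_one, sub_zero, smul_eq_mul]
    rw [mul_assoc, ← Real.exp_add]
    congr 2
    ring
  constructor
  · rw [gaussianReal_of_var_ne_zero _ one_ne_zero,
      integrable_withDensity_iff_integrable_smul₀' (by fun_prop)
        (Eventually.of_forall fun x => gaussianPDF_lt_top)]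
    refine ((integrable_exp_neg_mul_sq hb).const_mul (√(2 * Real.pi))⁻¹).congr
      (Eventually.of_forall fun x => ?_)
    simp only [toReal_gaussianPDF]
    exact (key x).symm
  · rw [integral_gaussianReal_eq_integral_smul one_ne_zero]
    simp_rw [key]
    rw [integral_const_mul, integral_gaussian, ← Real.sqrt_inv, ← Real.sqrt_mul (by positivity)]
    rw [Real.sqrt_le_left (Real.exp_pos _).le, ← Real.exp_nat_mul]
    have h1 : (2 * Real.pi)⁻¹ * (Real.pi / (1 / 2 - l)) = (1 - 2 * l)⁻¹ := by
      have : (1 : ℝ) - 2 * l ≠ 0 := by linarith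
      field_simp
    rw [h1, ← Real.exp_log (inv_pos.2 (by linarith : (0 : ℝ) < 1 - 2 * l)), Real.log_inv]
    refine Real.exp_le_exp.2 ?_
    have h2 : |2 * l| ≤ 1 / 2 := by rw [abs_mul, abs_two]; linarith
    have h3 := Real.abs_log_sub_add_sum_range_le (x := 2 * l) (by linarith) 1
    simp only [Finset.sum_range_one, zero_add, pow_one, Nat.cast_zero, div_one,
      one_add_one_eq_two, sq_abs] at h3
    have h4 : (2 * l) ^ 2 / (1 - |2 * l|) ≤ 2 * (2 * l) ^ 2 := by
      rw [div_le_iff₀ (by linarith)]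
      nlinarith [sq_nonneg (2 * l)]
    have h5 := (abs_le.1 (h3.trans h4)).1
    push_cast
    linarith

/-- The squared Frobenius norm of a matrix. -/
def frobSq {α β : Type*} [Fintype α] [Fintype β] (M : Matrix α β ℝ) : ℝ := ∑ i, ∑ j, M i j ^ 2

section

variable {ι α : Type*} [Fintype ι] [Fintype α]

theorem frobSq_transpose (M : Matrix α ι ℝ) : frobSq Mᵀ = frobSq M :=
  Finset.sum_comm

theorem frobSq_eq_trace {S : Matrix ι ι ℝ} (hS : S.IsSymm) : frobSq S = (S * S).trace := by
  simp only [frobSq, Matrix.trace, Matrix.diag, Matrix.mul_apply]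
  refine Finset.sum_congr rfl fun i _ => Finset.sum_congr rfl fun j _ => ?_
  rw [hS.apply i j, sq]

theorem frobSq_mul_le {γ : Type*} [Fintype γ] {L : Matrix α ι ℝ} {k : ℝ}
    (hL : ∀ v, (v ᵥ* L) ⬝ᵥ (v ᵥ* L) ≤ k * (v ⬝ᵥ v)) (M : Matrix γ α ℝ) :
    frobSq (M * L) ≤ k * frobSq M := by
  rw [frobSq, frobSq, Finset.mul_sum]
  refine Finset.sum_le_sum fun i _ => ?_
  have := hL (M i)
  simpa [dotProduct, vecMul, Matrix.mul_apply, sq] using this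

theorem frobSq_conj_le {L : Matrix α ι ℝ} {k : ℝ} (hk : 0 ≤ k)
    (hL : ∀ v, (v ᵥ* L) ⬝ᵥ (v ᵥ* L) ≤ k * (v ⬝ᵥ v)) {A : Matrix α α ℝ} (hA : A.IsSymm) :
    frobSq (Lᵀ * A * L) ≤ k ^ 2 * frobSq A := by
  have h1 : frobSq (Lᵀ * A) = frobSq (A * L) := by
    rw [← frobSq_transpose, Matrix.transpose_mul, Matrix.transpose_transpose, hA.eq]
  calc frobSq (Lᵀ * A * L) ≤ k * frobSq (Lᵀ * A) := frobSq_mul_le hL _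
    _ = k * frobSq (A * L) := by rw [h1]
    _ ≤ k * (k * frobSq A) := mul_le_mul_of_nonneg_left (frobSq_mul_le hL _) hk
    _ = _ := by ring

/-- A matrix and its transpose have the same operator norm: write `|Lx|² = ⟨Lᵀ(Lx), x⟩`, apply
Cauchy–Schwarz and cancel `|Lx|²`. -/
theorem mulVec_dotProduct_self_le {L : Matrix α ι ℝ} {k : ℝ} (hk : 0 ≤ k)
    (hL : ∀ v, (v ᵥ* L) ⬝ᵥ (v ᵥ* L) ≤ k * (v ⬝ᵥ v)) (x : ι → ℝ) :
    (L *ᵥ x) ⬝ᵥ (L *ᵥ x) ≤ k * (x ⬝ᵥ x) := by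
  set y := L *ᵥ x with hy
  have h1 : y ⬝ᵥ y = (y ᵥ* L) ⬝ᵥ x := by rw [← Matrix.dotProduct_mulVec]
  have h2 : ((y ᵥ* L) ⬝ᵥ x) ^ 2 ≤ ((y ᵥ* L) ⬝ᵥ (y ᵥ* L)) * (x ⬝ᵥ x) := by
    have := Finset.sum_mul_sq_le_sq_mul_sq Finset.univ (y ᵥ* L) x
    simpa [dotProduct, sq] using this
  have hx : 0 ≤ x ⬝ᵥ x := Finset.sum_nonneg fun i _ => mul_self_nonneg _
  have hyy : 0 ≤ y ⬝ᵥ y := Finset.sum_nonneg fun i _ => mul_self_nonneg _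
  rcases hyy.eq_or_lt with h0 | h0
  · rw [← h0]; positivity
  · have h3 : (y ⬝ᵥ y) ^ 2 ≤ k * (y ⬝ᵥ y) * (x ⬝ᵥ x) := by
      calc (y ⬝ᵥ y) ^ 2 = ((y ᵥ* L) ⬝ᵥ x) ^ 2 := by rw [← h1]
        _ ≤ _ := h2.trans (mul_le_mul_of_nonneg_right (hL y) hx)
    nlinarith

variable [DecidableEq ι]

/-- Exponential moment of a quadratic form of a standard Gaussian vector. -/
theorem integral_exp_quadratic_le {S : Matrix ι ι ℝ} (hS : S.IsSymm)
    (hop : ∀ v, |v ⬝ᵥ S *ᵥ v| ≤ 1 / 4 * (v ⬝ᵥ v)) :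
    Integrable (fun x => Real.exp (x ⬝ᵥ S *ᵥ x)) (Measure.pi fun _ : ι => gaussianReal 0 1) ∧
      ∫ x, Real.exp (x ⬝ᵥ S *ᵥ x) ∂(Measure.pi fun _ : ι => gaussianReal 0 1) ≤
        Real.exp (S.trace + 4 * frobSq S) := by
  have hH : S.IsHermitian := by
    rw [Matrix.IsHermitian, Matrix.conjTranspose_eq_transpose_of_trivial]; exact hS
  set b := hH.eigenvectorBasis with hb
  set l := hH.eigenvalues with hl
  set γ := Measure.pi fun _ : ι => gaussianReal 0 1 with hγ
  have hmb : ∀ i, S *ᵥ (b i).ofLp = l i • (b i).ofLp := hH.mulVec_eigenvectorBasis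
  have hdot : ∀ i j, (b i).ofLp ⬝ᵥ (b j).ofLp = if i = j then 1 else 0 := by
    intro i j
    have := orthonormal_iff_ite.1 b.orthonormal i j
    rw [← this, EuclideanSpace.inner_eq_star_dotProduct, dotProduct_comm]
    simp
  have hquad : ∀ z : ι → ℝ, (∑ i, z i • b i).ofLp ⬝ᵥ S *ᵥ (∑ i, z i • b i).ofLp =
      ∑ i, l i * z i ^ 2 := by
    intro z
    simp only [WithLp.ofLp_sum, WithLp.ofLp_smul, Matrix.mulVec_sum, Matrix.mulVec_smul, hmb,
      sum_dotProduct, dotProduct_sum, smul_dotProduct, dotProduct_smul, hdot, smul_eq_mul,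
      mul_ite, mul_zero]
    refine Finset.sum_congr rfl fun i _ => ?_
    simp
    ring
  have hl4 : ∀ i, |l i| ≤ 1 / 4 := by
    intro i
    have := hop (b i).ofLp
    simpa [hmb, dotProduct_smul, hdot] using this
  -- Rotation invariance: coordinates in the eigenbasis of `S` are again i.i.d. standard Gaussian,
  -- so the integral factors over eigenvalues.
  have hmapE : Measure.map (WithLp.toLp 2) γ =
      Measure.map (fun z : ι → ℝ => ∑ i, z i • b i) γ := by
    rw [hγ, map_pi_eq_stdGaussian, stdGaussian_eq_map_pi_orthonormalBasis b]
  have hmap : γ.map (fun z : ι → ℝ => (∑ i, z i • b i).ofLp) = γ := by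
    have := congrArg (Measure.map (WithLp.ofLp : EuclideanSpace ℝ ι → ι → ℝ)) hmapE
    rw [Measure.map_map (by fun_prop) (by fun_prop),
      Measure.map_map (by fun_prop) (by fun_prop)] at this
    simpa [Function.comp_def] using this.symm
  have hmeas : Measurable fun z : ι → ℝ => (∑ i, z i • b i).ofLp := by fun_prop
  have hcont : Continuous fun x : ι → ℝ => Real.exp (x ⬝ᵥ S *ᵥ x) := by fun_prop
  have hprod : ∀ z : ι → ℝ, Real.exp ((∑ i, z i • b i).ofLp ⬝ᵥ S *ᵥ (∑ i, z i • b i).ofLp) =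
      ∏ i, Real.exp (l i * z i ^ 2) := by
    intro z; rw [hquad, Real.exp_sum]
  have htr : S.trace = ∑ i, l i := by
    rw [hH.trace_eq_sum_eigenvalues]; rfl
  have hfr : frobSq S = ∑ i, l i ^ 2 := by
    rw [frobSq_eq_trace hS]
    have h1 := LinearMap.trace_eq_sum_inner (𝕜 := ℝ) (Matrix.toLpLin 2 2 (S * S)) b
    have h2 : LinearMap.trace ℝ _ (Matrix.toLpLin 2 2 (S * S)) = (S * S).trace := by
      rw [Matrix.toLpLin_eq_toLin, Matrix.trace_toLin_eq]
    rw [← h2, h1]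
    refine Finset.sum_congr rfl fun i _ => ?_
    rw [EuclideanSpace.inner_eq_star_dotProduct, Matrix.ofLp_toLpLin, Matrix.toLin'_apply,
      ← Matrix.mulVec_mulVec, hmb, Matrix.mulVec_smul, hmb]
    simp [hdot, sq]
  rw [← hmap] 
  rw [integrable_map_measure hcont.aestronglyMeasurable hmeas.aemeasurable,
    integral_map hmeas.aemeasurable hcont.aestronglyMeasurable]
  simp only [Function.comp_def, hprod]
  refine ⟨Integrable.fintype_prod fun i => (exp_mul_sq_gaussianReal (hl4 i)).1, ?_⟩
  rw [integral_fintype_prod_eq_prod (fun i x => Real.exp (l i * x ^ 2)), htr, hfr, Finset.mul_sum,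
    ← Finset.sum_add_distrib, Real.exp_sum]
  exact Finset.prod_le_prod (fun i _ => integral_nonneg fun x => (Real.exp_pos _).le)
    fun i _ => (exp_mul_sq_gaussianReal (hl4 i)).2

/-- Chernoff bound for a quadratic form in linear forms of a standard Gaussian vector. -/
theorem measure_quadratic_nonneg_le {L : Matrix α ι ℝ} {A : Matrix α α ℝ} {k β : ℝ} (hk : 0 ≤ k)
    (hA : A.IsSymm) (hL : ∀ v, (v ᵥ* L) ⬝ᵥ (v ᵥ* L) ≤ k * (v ⬝ᵥ v))
    (hβ : ∀ v, |v ⬝ᵥ A *ᵥ v| ≤ β * (v ⬝ᵥ v)) (hβ0 : 0 ≤ β) {t : ℝ} (ht : 0 ≤ t)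
    (hkβ : t * (β * k) ≤ 1 / 4) :
    (Measure.pi fun _ : ι => gaussianReal 0 1).real {x | 0 ≤ (L *ᵥ x) ⬝ᵥ A *ᵥ (L *ᵥ x)} ≤
      Real.exp (t * (A * (L * Lᵀ)).trace + 4 * t ^ 2 * k ^ 2 * frobSq A) := by
  set S := Lᵀ * (t • A) * L with hSdef
  have hS : S.IsSymm := by
    simp only [hSdef, Matrix.IsSymm, Matrix.transpose_mul, Matrix.transpose_transpose,
      Matrix.transpose_smul, hA.eq, Matrix.mul_assoc]
  have hq : ∀ x, x ⬝ᵥ S *ᵥ x = t * ((L *ᵥ x) ⬝ᵥ A *ᵥ (L *ᵥ x)) := by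
    intro x
    rw [hSdef, ← Matrix.mulVec_mulVec, ← Matrix.mulVec_mulVec, Matrix.dotProduct_mulVec,
      Matrix.vecMul_transpose, Matrix.smul_mulVec, dotProduct_smul, smul_eq_mul]
  have hop : ∀ v, |v ⬝ᵥ S *ᵥ v| ≤ 1 / 4 * (v ⬝ᵥ v) := by
    intro v
    have hv : 0 ≤ v ⬝ᵥ v := Finset.sum_nonneg fun i _ => mul_self_nonneg _
    rw [hq, abs_mul, abs_of_nonneg ht]
    calc t * |(L *ᵥ v) ⬝ᵥ A *ᵥ (L *ᵥ v)| ≤ t * (β * (k * (v ⬝ᵥ v))) :=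
          mul_le_mul_of_nonneg_left ((hβ _).trans
            (mul_le_mul_of_nonneg_left (mulVec_dotProduct_self_le hk hL v) hβ0)) ht
      _ = t * (β * k) * (v ⬝ᵥ v) := by ring
      _ ≤ _ := mul_le_mul_of_nonneg_right hkβ hv
  obtain ⟨hint, hle⟩ := integral_exp_quadratic_le hS hop
  -- Markov's inequality at level 1 for the exponential of `t` times the form.
  have hM := mul_meas_ge_le_integral_of_nonneg
    (Eventually.of_forall fun x => (Real.exp_pos (x ⬝ᵥ S *ᵥ x)).le) hint 1
  rw [one_mul] at hM
  refine (measureReal_mono ?_ (measure_ne_top _ _)).trans (hM.trans (hle.trans ?_))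
  · intro x hx
    simp only [Set.mem_ofPred_eq] at hx ⊢
    rw [Real.one_le_exp_iff, hq]
    positivity
  · refine Real.exp_le_exp.2 (add_le_add (le_of_eq ?_) ?_)
    · rw [hSdef, Matrix.mul_assoc, Matrix.trace_mul_comm, Matrix.mul_assoc, Matrix.smul_mul,
        Matrix.trace_smul, smul_eq_mul]
    · have h1 := frobSq_conj_le hk hL (A := t • A) (by
        rw [Matrix.IsSymm, Matrix.transpose_smul, hA.eq])
      have h2 : frobSq (t • A) = t ^ 2 * frobSq A := by
        simp [frobSq, mul_pow, Finset.mul_sum]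
      rw [h2] at h1
      nlinarith
end

/-! ### The model as one standard Gaussian vector -/

/-- The joint law of the signal graph and the noise graphs. -/
def noiseLaw (n p : ℕ) : Measure (WGraph n × (Fin p → WGraph n)) :=
  (gaussianGraph n).prod (Measure.pi fun _ => gaussianGraph n)

instance instIsProbabilityMeasureGaussianGraph (n : ℕ) :
    IsProbabilityMeasure (gaussianGraph n) := by
  unfold gaussianGraph; infer_instance

instance instIsProbabilityMeasureNoiseLaw (n p : ℕ) : IsProbabilityMeasure (noiseLaw n p) := by
  unfold noiseLaw; infer_instance

/-- All the Gaussian variables of the model, as a single vector. -/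
def flatten {n p : ℕ} (w : WGraph n × (Fin p → WGraph n)) : Edge n ⊕ Fin p × Edge n → ℝ :=
  Sum.elim w.1 fun x => w.2 x.1 x.2

theorem measurable_flatten {n p : ℕ} : Measurable (flatten : _ → Edge n ⊕ Fin p × Edge n → ℝ) := by
  refine measurable_pi_iff.2 fun i => ?_
  rcases i with e | x
  · exact (measurable_pi_apply e).comp measurable_fst
  · exact (measurable_pi_apply x.2).comp ((measurable_pi_apply x.1).comp measurable_snd)

theorem map_flatten_noiseLaw (n p : ℕ) :
    (noiseLaw n p).map flatten =
      Measure.pi fun _ : Edge n ⊕ Fin p × Edge n => gaussianReal 0 1 := by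
  refine (Measure.pi_eq fun s hs => ?_).symm
  rw [Measure.map_apply measurable_flatten (MeasurableSet.univ_pi hs)]
  have : flatten ⁻¹' (Set.univ.pi s) = (Set.univ.pi fun e : Edge n => s (Sum.inl e)) ×ˢ
      (Set.univ.pi fun j : Fin p => Set.univ.pi fun e : Edge n => s (Sum.inr (j, e))) := by
    ext w
    simp [flatten]
  rw [this, noiseLaw, Measure.prod_prod, Measure.pi_pi, gaussianGraph, Measure.pi_pi]
  simp_rw [Measure.pi_pi]
  rw [Fintype.prod_sum_type, Fintype.prod_prod_type]

/-! ### Score differences as quadratic forms -/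

/-- The incidence matrix of a tuple of permutations: it maps a tuple of weighted graphs to the sum
of the relabelled graphs. -/
def alignMatrix {n q : ℕ} (τ : Fin q → Equiv.Perm (Edge n)) :
    Matrix (Edge n) (Fin q × Edge n) ℝ :=
  Matrix.of fun g x => if τ x.1 x.2 = g then 1 else 0

/-- The number of ordered pairs of graphs and edges on which the permutations disagree. -/
def disagreement {n q : ℕ} (τ : Fin q → Equiv.Perm (Edge n)) : ℝ :=
  ∑ i, ∑ j, ∑ e, if τ i e = τ j e then 0 else 1

section

variable {n q : ℕ} (τ : Fin q → Equiv.Perm (Edge n))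

theorem alignMatrix_mulVec (x : Fin q × Edge n → ℝ) (g : Edge n) :
    (alignMatrix τ *ᵥ x) g = ∑ j, x (j, (τ j).symm g) := by
  simp only [mulVec, dotProduct, alignMatrix, Matrix.of_apply, ite_mul, one_mul, zero_mul,
    Fintype.sum_prod_type]
  refine Finset.sum_congr rfl fun j _ => ?_
  simp [← Equiv.eq_symm_apply]

/-- The matrix of the score of a tuple of permutations. -/
def gramMatrix : Matrix (Fin q × Edge n) (Fin q × Edge n) ℝ := (alignMatrix τ)ᵀ * alignMatrix τ

theorem gramMatrix_apply (x y : Fin q × Edge n) :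
    gramMatrix τ x y = if τ x.1 x.2 = τ y.1 y.2 then 1 else 0 := by
  simp [gramMatrix, Matrix.mul_apply, alignMatrix, eq_comm]

theorem gramMatrix_one_apply (x y : Fin q × Edge n) :
    gramMatrix (fun _ => 1) x y = if x.2 = y.2 then 1 else 0 :=
  gramMatrix_apply _ x y

theorem quadratic_gram (x : Fin q × Edge n → ℝ) :
    x ⬝ᵥ gramMatrix τ *ᵥ x = ∑ g, (∑ j, x (j, (τ j).symm g)) ^ 2 := by
  rw [gramMatrix, ← Matrix.mulVec_mulVec, Matrix.dotProduct_mulVec, Matrix.vecMul_transpose]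
  simp [dotProduct, alignMatrix_mulVec, sq]

theorem quadratic_gram_nonneg (x : Fin q × Edge n → ℝ) :
    0 ≤ x ⬝ᵥ gramMatrix τ *ᵥ x := by
  rw [quadratic_gram]; positivity

/-- Cauchy–Schwarz on the `q` terms meeting at each edge. -/
theorem quadratic_gram_le (x : Fin q × Edge n → ℝ) :
    x ⬝ᵥ gramMatrix τ *ᵥ x ≤ q * (x ⬝ᵥ x) := by
  rw [quadratic_gram]
  have h : x ⬝ᵥ x = ∑ g, ∑ j, x (j, (τ j).symm g) ^ 2 := by
    rw [Finset.sum_comm, dotProduct, Fintype.sum_prod_type]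
    refine Finset.sum_congr rfl fun j _ => ?_
    rw [Equiv.sum_comp (τ j).symm fun g => x (j, g) ^ 2]
    exact Finset.sum_congr rfl fun g _ => (sq _).symm
  rw [h, Finset.mul_sum]
  refine Finset.sum_le_sum fun g _ => ?_
  simpa using sq_sum_le_card_mul_sum_sq (s := Finset.univ) (f := fun j => x (j, (τ j).symm g))

/-- The matrix of the difference between the score of `τ` and that of the identity. -/
def scoreMatrix : Matrix (Fin q × Edge n) (Fin q × Edge n) ℝ :=
  gramMatrix τ - gramMatrix fun _ => 1

theorem scoreMatrix_isSymm : (scoreMatrix τ).IsSymm := by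
  simp [Matrix.IsSymm, scoreMatrix, gramMatrix, Matrix.transpose_sub, Matrix.transpose_mul]

theorem scoreMatrix_apply (x y : Fin q × Edge n) :
    scoreMatrix τ x y =
      (if τ x.1 x.2 = τ y.1 y.2 then 1 else 0) - if x.2 = y.2 then 1 else 0 := by
  rw [scoreMatrix, Matrix.sub_apply, gramMatrix_apply, gramMatrix_one_apply]

/-- Both Gram forms lie between `0` and `q |x|²`, so their difference costs `q` rather than `2q`. -/
theorem abs_quadratic_scoreMatrix_le (x : Fin q × Edge n → ℝ) :
    |x ⬝ᵥ scoreMatrix τ *ᵥ x| ≤ q * (x ⬝ᵥ x) := by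
  rw [scoreMatrix, Matrix.sub_mulVec, dotProduct_sub]
  exact abs_sub_le_of_nonneg_of_le (quadratic_gram_nonneg _ x) (quadratic_gram_le _ x)
    (quadratic_gram_nonneg _ x) (quadratic_gram_le _ x)

/-- For fixed `i`, `j`, `e`, the row has a `+1` at `(τ j)⁻¹ (τ i e)` and a `-1` at `e`. They cancel
on agreement; otherwise both squares count. -/
theorem frobSq_scoreMatrix : frobSq (scoreMatrix τ) = 2 * disagreement τ := by
  simp only [frobSq, Fintype.sum_prod_type, disagreement, Finset.mul_sum]
  refine Finset.sum_congr rfl fun i _ => ?_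
  rw [Finset.sum_comm]
  refine Finset.sum_congr rfl fun j _ => Finset.sum_congr rfl fun e _ => ?_
  have h : ∀ f, scoreMatrix τ (i, e) (j, f) ^ 2 =
      (if (τ j).symm (τ i e) = f then 1 else 0) + (if e = f then 1 else 0) -
        2 * (if e = f then (if τ i e = τ j e then 1 else 0) else 0) := by
    intro f
    rw [scoreMatrix_apply]
    simp only [Equiv.symm_apply_eq]
    by_cases h1 : e = f
    · subst h1; by_cases h2 : τ i e = τ j e <;> norm_num [h2]
    · by_cases h2 : τ i e = τ j f <;> simp [h1, h2]
  simp only [h, Finset.sum_sub_distrib, Finset.sum_add_distrib, ← Finset.mul_sum,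
    Finset.sum_ite_eq, Finset.mem_univ, if_true]
  split_ifs <;> norm_num

/-- The coefficients of the observed graphs `a j`, relabelled by the planted permutations, as linear
forms in the Gaussian variables of the model. -/
def coeffMatrix {p : ℕ} (ρ : ℝ) (a : Fin q → Fin p) (s : Fin p → NodePerm n) :
    Matrix (Fin q × Edge n) (Edge n ⊕ Fin p × Edge n) ℝ :=
  Matrix.of fun x => Sum.elim (fun f => if x.2 = f then √ρ else 0)
    fun y => if (a x.1, (edgePerm (s (a x.1))).symm x.2) = y then √(1 - ρ) else 0

variable {p : ℕ} {ρ : ℝ} {a : Fin q → Fin p} (s : Fin p → NodePerm n)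

theorem coeffMatrix_mulVec_flatten (w : WGraph n × (Fin p → WGraph n)) (x : Fin q × Edge n) :
    (coeffMatrix ρ a s *ᵥ flatten w) x =
      observed ρ (s, w) (a x.1) ((edgePerm (s (a x.1))).symm x.2) := by
  simp [coeffMatrix, mulVec, dotProduct, flatten, observed]

/-- The covariance of the aligned observations: the signal is shared along each edge, and
injectivity of `a` keeps the noise of distinct graphs independent. -/
theorem coeffMatrix_mul_transpose (h0 : 0 ≤ ρ) (h1 : ρ ≤ 1) (ha : Function.Injective a) :
    coeffMatrix ρ a s * (coeffMatrix ρ a s)ᵀ =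
      ρ • gramMatrix (fun _ => 1) +
        (1 - ρ) • (1 : Matrix (Fin q × Edge n) (Fin q × Edge n) ℝ) := by
  ext ⟨i, e⟩ ⟨j, f⟩
  have h : ((a i, (edgePerm (s (a i))).symm e) = (a j, (edgePerm (s (a j))).symm f)) ↔
      (i, e) = (j, f) := by
    constructor
    · intro h
      have h2 := ha (Prod.ext_iff.1 h).1
      subst h2
      simpa using h
    · intro h
      rw [Prod.mk.injEq] at h
      obtain ⟨rfl, rfl⟩ := h
      rfl
  rw [Matrix.add_apply, Matrix.smul_apply, Matrix.smul_apply, gramMatrix_one_apply,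
    Matrix.one_apply, Matrix.mul_apply, Fintype.sum_sum_type]
  simp only [coeffMatrix, Matrix.transpose_apply, Matrix.of_apply, Sum.elim_inl, Sum.elim_inr,
    ite_mul, zero_mul, Finset.sum_ite_eq, Finset.mem_univ, if_true, mul_ite, mul_zero,
    smul_eq_mul, mul_one]
  rw [Real.mul_self_sqrt h0, Real.mul_self_sqrt (by linarith)]
  congr 1
  exact if_congr h rfl rfl

/-- This is the mean of the score difference. The noise part vanishes because `scoreMatrix` has zero
diagonal; the signal part sums the entries with equal edges, each `-1` on a disagreement. -/
theorem trace_scoreMatrix_mul (h0 : 0 ≤ ρ) (h1 : ρ ≤ 1) (ha : Function.Injective a) :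
    (scoreMatrix τ * (coeffMatrix ρ a s * (coeffMatrix ρ a s)ᵀ)).trace =
      -(ρ * disagreement τ) := by
  rw [coeffMatrix_mul_transpose s h0 h1 ha, Matrix.mul_add, Matrix.trace_add, Matrix.mul_smul,
    Matrix.trace_smul, Matrix.mul_smul, Matrix.trace_smul, Matrix.mul_one]
  have h2 : (scoreMatrix τ).trace = 0 := by
    simp [Matrix.trace, scoreMatrix_apply]
  have h3 : (scoreMatrix τ * gramMatrix (fun _ => 1)).trace = -disagreement τ := by
    simp only [Matrix.trace, Matrix.diag, Matrix.mul_apply, gramMatrix_one_apply,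
      Fintype.sum_prod_type, disagreement, ← Finset.sum_neg_distrib]
    refine Finset.sum_congr rfl fun i _ => ?_
    rw [Finset.sum_comm]
    refine Finset.sum_congr rfl fun j _ => Finset.sum_congr rfl fun e _ => ?_
    simp only [scoreMatrix_apply, mul_ite, mul_one, mul_zero,
      Finset.sum_ite_eq', Finset.mem_univ, if_true]
    split_ifs <;> norm_num
  rw [h2, h3]
  simp

theorem vecMul_coeffMatrix_le (h0 : 0 ≤ ρ) (h1 : ρ ≤ 1) (ha : Function.Injective a)
    (v : Fin q × Edge n → ℝ) :
    (v ᵥ* coeffMatrix ρ a s) ⬝ᵥ (v ᵥ* coeffMatrix ρ a s) ≤ (ρ * q + 1) * (v ⬝ᵥ v) := by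
  have hv : 0 ≤ v ⬝ᵥ v := Finset.sum_nonneg fun i _ => mul_self_nonneg _
  rw [← Matrix.mulVec_transpose, Matrix.dotProduct_mulVec, Matrix.vecMul_transpose,
    dotProduct_comm, Matrix.mulVec_mulVec, coeffMatrix_mul_transpose s h0 h1 ha,
    Matrix.add_mulVec, dotProduct_add, Matrix.smul_mulVec, Matrix.smul_mulVec, dotProduct_smul,
    dotProduct_smul, Matrix.one_mulVec, smul_eq_mul, smul_eq_mul]
  have := mul_le_mul_of_nonneg_left
    (quadratic_gram_le (fun _ : Fin q => (1 : Equiv.Perm (Edge n))) v) h0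
  nlinarith

end

theorem edgePerm_mul {n : ℕ} (σ τ : NodePerm n) : edgePerm (σ * τ) = edgePerm σ * edgePerm τ := by
  ext e
  simp [edgePerm, Sym2.map_map]

/-- The score of a relabelling of the planted permutations, minus the score of the latter. -/
theorem score_sub_score {n p q : ℕ} {ρ : ℝ} (a : Fin q → Fin p) (s : Fin p → NodePerm n)
    (ν : Fin q → NodePerm n) (w : WGraph n × (Fin p → WGraph n)) :
    (coeffMatrix ρ a s *ᵥ flatten w) ⬝ᵥ
        scoreMatrix (fun j => edgePerm (ν j)) *ᵥ (coeffMatrix ρ a s *ᵥ flatten w) =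
      score (fun j => observed ρ (s, w) (a j)) (fun j => ν j * s (a j)) -
        score (fun j => observed ρ (s, w) (a j)) (fun j => s (a j)) := by
  rw [scoreMatrix, Matrix.sub_mulVec, dotProduct_sub, quadratic_gram, quadratic_gram]
  simp only [coeffMatrix_mulVec_flatten, score, edgePerm_mul]
  rfl

/-- A relabelling of the planted permutations beats them with exponentially small probability. -/
theorem measure_score_le {n p q : ℕ} {ρ k : ℝ} (h0 : 0 ≤ ρ) (h1 : ρ ≤ 1) (hk : ρ * q + 1 ≤ k)
    {a : Fin q → Fin p} (ha : Function.Injective a) (s : Fin p → NodePerm n)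
    (ν : Fin q → NodePerm n) :
    (noiseLaw n p).real {w | score (fun j => observed ρ (s, w) (a j)) (fun j => s (a j)) ≤
        score (fun j => observed ρ (s, w) (a j)) (fun j => ν j * s (a j))} ≤
      Real.exp (-(ρ ^ 2 / (32 * k ^ 2) * disagreement fun j => edgePerm (ν j))) := by
  have hk1 : 1 ≤ k := by nlinarith [mul_nonneg h0 (Nat.cast_nonneg (α := ℝ) q)]
  set L := coeffMatrix ρ a s
  set A := scoreMatrix fun j => edgePerm (ν j)
  have hset : {w | score (fun j => observed ρ (s, w) (a j)) (fun j => s (a j)) ≤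
        score (fun j => observed ρ (s, w) (a j)) (fun j => ν j * s (a j))} =
      flatten ⁻¹' {x | 0 ≤ (L *ᵥ x) ⬝ᵥ A *ᵥ (L *ᵥ x)} := by
    ext w
    simp only [Set.mem_ofPred_eq, Set.mem_preimage]
    rw [score_sub_score, sub_nonneg]
  have hmeas : MeasurableSet {x | 0 ≤ (L *ᵥ x) ⬝ᵥ A *ᵥ (L *ᵥ x)} :=
    (isClosed_le continuous_const (by fun_prop)).measurableSet
  rw [hset, ← map_measureReal_apply measurable_flatten hmeas, map_flatten_noiseLaw]
  have hL : ∀ v, (v ᵥ* L) ⬝ᵥ (v ᵥ* L) ≤ k * (v ⬝ᵥ v) := fun v =>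
    (vecMul_coeffMatrix_le s h0 h1 ha v).trans (mul_le_mul_of_nonneg_right hk
      (Finset.sum_nonneg fun i _ => mul_self_nonneg _))
  -- With this `t`, the mean contributes `-ρ² D / (16 k²)` and the second-order term gives back half
  -- of it; `ρ q ≤ k` ensures the smallness condition on `t`.
  refine (measure_quadratic_nonneg_le (t := ρ / (16 * k ^ 2)) (by linarith)
    (scoreMatrix_isSymm _) hL (abs_quadratic_scoreMatrix_le _) (Nat.cast_nonneg q)
    (by positivity) ?_).trans ?_
  · have : ρ / (16 * k ^ 2) * (q * k) = ρ * q / (16 * k) := by field_simp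
    rw [this, div_le_div_iff₀ (by positivity) (by norm_num)]
    linarith
  · rw [trace_scoreMatrix_mul _ s h0 h1 ha, frobSq_scoreMatrix]
    refine Real.exp_le_exp.2 (le_of_eq ?_)
    field_simp
    ring

/-! ### Hamming distances: edges versus nodes, and generating sums -/

theorem hammingDist_mul_left {n : ℕ} (ψ σ τ : NodePerm n) :
    hammingDist ⇑(ψ * σ) ⇑(ψ * τ) = hammingDist ⇑σ ⇑τ :=
  hammingDist_comp (fun _ => ψ) fun _ => ψ.injective

/-- Two node permutations that disagree on `d` nodes disagree on at least `d (n - 2) / 2` edges. -/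
theorem hammingDist_mul_le_two_mul_card {n : ℕ} (σ τ : NodePerm n) :
    hammingDist ⇑σ ⇑τ * (n - 2) ≤
      2 * (Finset.univ.filter fun e : Edge n => edgePerm σ e ≠ edgePerm τ e).card := by
  classical
  set D := Finset.univ.filter fun u => σ u ≠ τ u with hD
  -- If `σ u ≠ τ u`, the images of `{u, v}` can agree only when `τ` swaps the roles of the
  -- endpoints, which forces `v = τ⁻¹ (σ u)`. Excluding this `v` and `u` itself leaves at least `n -
  -- 2` partners; each edge arises from at most two ordered pairs.
  set P : Finset (Fin n × Fin n) := D.biUnion fun u =>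
    (Finset.univ \ {u, τ.symm (σ u)}).image fun v => (u, v) with hP
  set t := (Finset.univ.filter fun e : Edge n => edgePerm σ e ≠ edgePerm τ e).map
    (Function.Embedding.subtype _) with ht
  have hmem : ∀ x : Fin n × Fin n, x ∈ P → σ x.1 ≠ τ x.1 ∧ x.2 ≠ x.1 ∧ τ x.2 ≠ σ x.1 := by
    rintro ⟨u, v⟩ hx
    simp only [hP, hD, Finset.mem_biUnion, Finset.mem_filter, Finset.mem_univ, true_and,
      Finset.mem_image, Finset.mem_sdiff, Finset.mem_insert, Finset.mem_singleton, not_or,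
      Prod.mk.injEq] at hx
    obtain ⟨u', hu, v', ⟨h1, h2⟩, rfl, rfl⟩ := hx
    exact ⟨hu, h1, fun h => h2 ((Equiv.eq_symm_apply _).2 h)⟩
  have hcard : hammingDist ⇑σ ⇑τ * (n - 2) ≤ P.card := by
    rw [hP, Finset.card_biUnion]
    · rw [hammingDist, ← hD, ← smul_eq_mul, ← Finset.sum_const]
      refine Finset.sum_le_sum fun u _ => ?_
      rw [Finset.card_image_of_injective _ (Prod.mk_right_injective u),
        Finset.card_sdiff_of_subset (Finset.subset_univ _), Finset.card_univ, Fintype.card_fin]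
      exact Nat.sub_le_sub_left (Finset.card_le_two) n
    · intro u _ v _ huv
      rw [Function.onFun, Finset.disjoint_left]
      intro x hx hy
      simp only [Finset.mem_image] at hx hy
      obtain ⟨_, _, rfl⟩ := hx
      obtain ⟨_, _, h⟩ := hy
      exact huv (Prod.ext_iff.1 h).1.symm
  have hmaps : P.card ≤ 2 * t.card := by
    refine Finset.card_le_mul_card_image_of_maps_to (f := fun x => s(x.1, x.2)) ?_ 2 ?_
    · rintro ⟨u, v⟩ hx
      obtain ⟨h1, h2, h3⟩ := hmem _ hx
      simp only [ht, Finset.mem_map, Finset.mem_filter, Finset.mem_univ, true_and]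
      refine ⟨⟨s(u, v), by simpa [eq_comm] using h2⟩, fun h => ?_, rfl⟩
      have h4 := congrArg Subtype.val h
      simp only [edgePerm, Equiv.coe_fn_mk, Sym2.map_mk, Sym2.eq_iff] at h4
      rcases h4 with h4 | h4
      · exact h1 h4.1
      · exact h3 h4.1.symm
    · intro e _
      induction e with
      | _ u v =>
        refine (Finset.card_le_card (t := {(u, v), (v, u)}) ?_).trans Finset.card_le_two
        rintro ⟨a, b⟩ hab
        simp only [Finset.mem_filter, Sym2.eq_iff] at hab
        simp only [Finset.mem_insert, Finset.mem_singleton, Prod.mk.injEq]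
        exact hab.2
  rw [ht, Finset.card_map] at hmaps
  exact hcard.trans hmaps

/-- The factor `n / 4` is `(n - 2) / 2` weakened by `n ≥ 4`. -/
theorem le_disagreement {n q : ℕ} (hn : 4 ≤ n) (ν : Fin q → NodePerm n) :
    (n : ℝ) / 4 * ∑ i, ∑ j, (hammingDist ⇑(ν i) ⇑(ν j) : ℝ) ≤
      disagreement fun j => edgePerm (ν j) := by
  rw [disagreement, Finset.mul_sum]
  refine Finset.sum_le_sum fun i _ => ?_
  rw [Finset.mul_sum]
  refine Finset.sum_le_sum fun j _ => ?_
  have h1 := hammingDist_mul_le_two_mul_card (ν i) (ν j)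
  have h2 : (hammingDist ⇑(ν i) ⇑(ν j) : ℝ) * (n - 2) ≤
      2 * (Finset.univ.filter fun e : Edge n => edgePerm (ν i) e ≠ edgePerm (ν j) e).card := by
    have : ((n - 2 : ℕ) : ℝ) = n - 2 := by rw [Nat.cast_sub (by omega)]; norm_num
    rw [← this]
    exact_mod_cast h1
  have h3 : (∑ e : Edge n, if edgePerm (ν i) e = edgePerm (ν j) e then (0 : ℝ) else 1) =
      (Finset.univ.filter fun e : Edge n => edgePerm (ν i) e ≠ edgePerm (ν j) e).card := by
    rw [Finset.card_filter]
    push_cast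
    exact Finset.sum_congr rfl fun e _ => by simp [ite_not]
  rw [h3]
  have h4 : (4 : ℝ) ≤ n := by exact_mod_cast hn
  nlinarith [Nat.cast_nonneg (α := ℝ) (hammingDist ⇑(ν i) ⇑(ν j))]

/-- Enlarging the sum to all maps `Fin n → Fin n` makes it factor over nodes, each factor being at
most `1 + n x`. -/
theorem sum_pow_hammingDist_le {n : ℕ} {x : ℝ} (hx : 0 ≤ x) :
    ∑ σ : NodePerm n, x ^ hammingDist ⇑σ ⇑(1 : NodePerm n) ≤ Real.exp ((n : ℝ) ^ 2 * x) := by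
  classical
  have h1 : ∀ f : Fin n → Fin n, x ^ hammingDist f id = ∏ u, if f u = u then 1 else x := by
    intro f
    rw [hammingDist, ← Finset.prod_const, Finset.prod_filter]
    exact Finset.prod_congr rfl fun u _ => by simp [ite_not]
  calc ∑ σ : NodePerm n, x ^ hammingDist ⇑σ ⇑(1 : NodePerm n)
      = ∑ f ∈ Finset.univ.map (⟨DFunLike.coe, DFunLike.coe_injective⟩ : NodePerm n ↪ (Fin n → Fin n)),
          x ^ hammingDist f id := by
        rw [Finset.sum_map]
        rfl
    _ ≤ ∑ f : Fin n → Fin n, x ^ hammingDist f id :=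
        Finset.sum_le_sum_of_subset_of_nonneg (Finset.subset_univ _) fun _ _ _ => by positivity
    _ = ∏ u : Fin n, ∑ v : Fin n, if v = u then 1 else x := by
        simp_rw [h1]
        rw [Finset.prod_univ_sum, Fintype.piFinset_univ]
    _ ≤ ∏ _u : Fin n, Real.exp (n * x) := by
        refine Finset.prod_le_prod
          (fun u _ => Finset.sum_nonneg fun v _ => by split_ifs <;> linarith) fun u _ => ?_
        refine le_trans ?_ (Real.add_one_le_exp _)
        calc ∑ v : Fin n, (if v = u then (1 : ℝ) else x)
            ≤ ∑ v : Fin n, ((if v = u then 1 else 0) + x) :=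
              Finset.sum_le_sum fun v _ => by split_ifs <;> linarith
          _ = n * x + 1 := by simp [Finset.sum_add_distrib, add_comm]
    _ = Real.exp ((n : ℝ) ^ 2 * x) := by
        rw [Finset.prod_const, Finset.card_univ, Fintype.card_fin, ← Real.exp_nat_mul]
        ring_nf

/-- The full sum factors over the tuple and is at most `exp y` with `y = q n² x`. Removing the
identity term leaves `exp y - 1 ≤ 2y` for `y ≤ 1`. -/
theorem sum_tuple_pow_hammingDist_le {n q : ℕ} {x : ℝ} (hx : 0 ≤ x)
    (hx1 : (q : ℝ) * n ^ 2 * x ≤ 1) :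
    ∑ ν ∈ Finset.univ.filter (fun ν : Fin q → NodePerm n => ν ≠ 1),
        x ^ ∑ j, hammingDist ⇑(ν j) ⇑(1 : NodePerm n) ≤ 2 * ((q : ℝ) * n ^ 2 * x) := by
  classical
  have h1 : ∑ ν : Fin q → NodePerm n, x ^ ∑ j, hammingDist ⇑(ν j) ⇑(1 : NodePerm n) ≤
      Real.exp (q * n ^ 2 * x) := by
    simp_rw [← Finset.prod_pow_eq_pow_sum]
    rw [← Fintype.piFinset_univ, ← Finset.prod_univ_sum (fun _ : Fin q => Finset.univ)
      fun _ (σ : NodePerm n) => x ^ hammingDist ⇑σ ⇑(1 : NodePerm n), Finset.prod_const, Finset.card_univ,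
      Fintype.card_fin, mul_assoc, Real.exp_nat_mul]
    exact pow_le_pow_left₀ (Finset.sum_nonneg fun _ _ => by positivity)
      (sum_pow_hammingDist_le hx) q
  have h2 : ∑ ν : Fin q → NodePerm n, x ^ ∑ j, hammingDist ⇑(ν j) ⇑(1 : NodePerm n) =
      1 + ∑ ν ∈ Finset.univ.filter (fun ν : Fin q → NodePerm n => ν ≠ 1),
        x ^ ∑ j, hammingDist ⇑(ν j) ⇑(1 : NodePerm n) := by
    rw [← Finset.sum_filter_add_sum_filter_not _ (fun ν : Fin q → NodePerm n => ν = 1)]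
    simp [Finset.filter_eq']
  have h3 : 0 ≤ (q : ℝ) * n ^ 2 * x := by positivity
  have h4 := Real.abs_exp_sub_one_le (x := (q : ℝ) * n ^ 2 * x) (by rwa [abs_of_nonneg h3])
  rw [abs_of_nonneg h3] at h4
  linarith [(abs_le.1 h4).2]

/-! ### Failure events and their union bounds -/

theorem score_mul_left {n q : ℕ} (g : Fin q → WGraph n) (ψ : NodePerm n)
    (σ : Fin q → NodePerm n) : score g (fun j => ψ * σ j) = score g σ := by
  rw [score, score, ← Equiv.sum_comp (edgePerm ψ)]
  refine Finset.sum_congr rfl fun e _ => ?_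
  simp only [edgePerm_mul]
  refine congrArg (· ^ 2) (Finset.sum_congr rfl fun j _ => congrArg (g j) ?_)
  rw [Equiv.symm_apply_eq]
  simp

/-- The first stage may fail: a relabelling of the planted permutations that is not global has at
least their score. -/
def jointFailure {n p q : ℕ} (ρ : ℝ) (a : Fin q → Fin p) (s : Fin p → NodePerm n) :
    Set (WGraph n × (Fin p → WGraph n)) :=
  {w | ∃ ν : Fin q → NodePerm n, (¬ ∀ i j, ν i = ν j) ∧
    score (fun j => observed ρ (s, w) (a j)) (fun j => s (a j)) ≤
      score (fun j => observed ρ (s, w) (a j)) (fun j => ν j * s (a j))}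

/-- The relabelling of the last of `q + 1` graphs. -/
def lastTuple {n : ℕ} (q : ℕ) (σ : NodePerm n) : Fin (q + 1) → NodePerm n :=
  Fin.snoc (α := fun _ => NodePerm n) (fun _ => 1) σ

/-- The last of `q + 1` graphs may be misaligned, given the others. -/
def lastFailure {n p q : ℕ} (ρ : ℝ) (a : Fin (q + 1) → Fin p) (s : Fin p → NodePerm n) :
    Set (WGraph n × (Fin p → WGraph n)) :=
  {w | ∃ σ : NodePerm n, σ ≠ 1 ∧
    score (fun j => observed ρ (s, w) (a j)) (fun j => s (a j)) ≤
      score (fun j => observed ρ (s, w) (a j)) (fun j => lastTuple q σ j * s (a j))}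

/-- The probability bound for one misplaced node. -/
def nodeBound (n q : ℕ) (ρ k : ℝ) : ℝ := Real.exp (-(ρ ^ 2 / (32 * k ^ 2) * (n / 4 * q)))

theorem measure_score_le_nodeBound_pow {n p q m d : ℕ} {ρ k : ℝ} (hn : 4 ≤ n) (h0 : 0 ≤ ρ)
    (h1 : ρ ≤ 1) (hk : ρ * q + 1 ≤ k) {a : Fin q → Fin p} (ha : Function.Injective a)
    (s : Fin p → NodePerm n) (ν : Fin q → NodePerm n)
    (hν : m * d ≤ ∑ i, ∑ j, hammingDist ⇑(ν i) ⇑(ν j)) :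
    (noiseLaw n p).real {w | score (fun j => observed ρ (s, w) (a j)) (fun j => s (a j)) ≤
        score (fun j => observed ρ (s, w) (a j)) (fun j => ν j * s (a j))} ≤
      nodeBound n m ρ k ^ d := by
  refine (measure_score_le h0 h1 hk ha s ν).trans ?_
  rw [nodeBound, ← Real.exp_nat_mul]
  refine Real.exp_le_exp.2 ?_
  have h2 : (m : ℝ) * d ≤ ∑ i, ∑ j, (hammingDist ⇑(ν i) ⇑(ν j) : ℝ) := by exact_mod_cast hν
  have h3 : (n : ℝ) / 4 * (m * d) ≤ disagreement fun j => edgePerm (ν j) :=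
    (mul_le_mul_of_nonneg_left h2 (by positivity)).trans (le_disagreement hn ν)
  have h4 := mul_le_mul_of_nonneg_left h3 (by positivity : 0 ≤ ρ ^ 2 / (32 * k ^ 2))
  nlinarith

theorem measure_jointFailure_le {n p q : ℕ} {ρ k : ℝ} (hn : 4 ≤ n) (h0 : 0 ≤ ρ) (h1 : ρ ≤ 1)
    (hk : ρ * q + 1 ≤ k) {a : Fin q → Fin p} (ha : Function.Injective a) (s : Fin p → NodePerm n)
    (hx : (q : ℝ) * n ^ 2 * nodeBound n q ρ k ≤ 1) :
    (noiseLaw n p).real (jointFailure ρ a s) ≤ 2 * ((q : ℝ) * n ^ 2 * nodeBound n q ρ k) := by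
  classical
  set T := Finset.univ.filter fun ν : Fin q → NodePerm n => ν ≠ 1 ∧
    q * ∑ j, hammingDist ⇑(ν j) ⇑(1 : NodePerm n) ≤ ∑ i, ∑ j, hammingDist ⇑(ν i) ⇑(ν j) with hT
  set ev := fun ν : Fin q → NodePerm n =>
    {w | score (fun j => observed ρ (s, w) (a j)) (fun j => s (a j)) ≤
        score (fun j => observed ρ (s, w) (a j)) (fun j => ν j * s (a j))} with hev
  have hsub : jointFailure ρ a s ⊆ ⋃ ν ∈ T, ev ν := by
    rintro w ⟨ν, hne, hle⟩
    have hq : Nonempty (Fin q) := by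
      by_contra h
      rw [not_nonempty_iff] at h
      exact hne fun i => isEmptyElim i
    -- The score ignores global relabellings, so `ν` may be recentred at its best member `i₀`. The
    -- minimum is at most the average, so `q` times the distance to the centre is bounded by the
    -- pairwise sum; without recentring this can fail.
    obtain ⟨i₀, hi₀⟩ := Finite.exists_min fun i => ∑ j, hammingDist ⇑(ν j) ⇑(ν i)
    simp only [Set.mem_iUnion, hT, Finset.mem_filter, Finset.mem_univ, true_and, exists_prop]
    refine ⟨fun j => (ν i₀)⁻¹ * ν j, ⟨fun h => hne fun i j => ?_, ?_⟩, ?_⟩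
    · have hi := congrFun h i
      have hj := congrFun h j
      simp only [Pi.one_apply, inv_mul_eq_one] at hi hj
      rw [← hi, ← hj]
    · have h2 : ∀ j, hammingDist ⇑((ν i₀)⁻¹ * ν j) ⇑(1 : NodePerm n) =
          hammingDist ⇑(ν j) ⇑(ν i₀) := fun j => by
        rw [← hammingDist_mul_left (ν i₀), mul_inv_cancel_left, mul_one]
      simp only [h2, hammingDist_mul_left]
      rw [Finset.sum_comm]
      calc q * ∑ j, hammingDist ⇑(ν j) ⇑(ν i₀)
          = ∑ _i : Fin q, ∑ j, hammingDist ⇑(ν j) ⇑(ν i₀) := by simp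
        _ ≤ _ := Finset.sum_le_sum fun i _ => hi₀ i
    · simp only [hev, Set.mem_ofPred_eq, mul_assoc]
      rwa [score_mul_left]
  calc (noiseLaw n p).real (jointFailure ρ a s) ≤ (noiseLaw n p).real (⋃ ν ∈ T, ev ν) :=
        measureReal_mono hsub (measure_ne_top _ _)
    _ ≤ ∑ ν ∈ T, (noiseLaw n p).real (ev ν) := measureReal_biUnion_finset_le _ _
    _ ≤ ∑ ν ∈ T, nodeBound n q ρ k ^ ∑ j, hammingDist ⇑(ν j) ⇑(1 : NodePerm n) :=
        Finset.sum_le_sum fun ν hν => measure_score_le_nodeBound_pow hn h0 h1 hk ha s ν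
          (Finset.mem_filter.1 hν).2.2
    _ ≤ ∑ ν ∈ Finset.univ.filter (fun ν : Fin q → NodePerm n => ν ≠ 1),
          nodeBound n q ρ k ^ ∑ j, hammingDist ⇑(ν j) ⇑(1 : NodePerm n) :=
        Finset.sum_le_sum_of_subset_of_nonneg
          (fun ν hν => by simpa using (Finset.mem_filter.1 hν).2.1)
          fun _ _ _ => pow_nonneg (Real.exp_pos _).le _
    _ ≤ _ := sum_tuple_pow_hammingDist_le (Real.exp_pos _).le hx

theorem measure_lastFailure_le {n p q : ℕ} {ρ k : ℝ} (hn : 4 ≤ n) (h0 : 0 ≤ ρ) (h1 : ρ ≤ 1)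
    (hk : ρ * (q + 1) + 1 ≤ k) {a : Fin (q + 1) → Fin p} (ha : Function.Injective a)
    (s : Fin p → NodePerm n) (hx : (n : ℝ) ^ 2 * nodeBound n q ρ k ≤ 1) :
    (noiseLaw n p).real (lastFailure ρ a s) ≤ 2 * ((n : ℝ) ^ 2 * nodeBound n q ρ k) := by
  classical
  set T := Finset.univ.filter fun ν : Fin 1 → NodePerm n => ν ≠ 1 with hT
  set ev := fun ν : Fin 1 → NodePerm n =>
    {w | score (fun j => observed ρ (s, w) (a j)) (fun j => s (a j)) ≤
        score (fun j => observed ρ (s, w) (a j)) (fun j => lastTuple q (ν 0) j * s (a j))} with hev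
  have hsub : lastFailure ρ a s ⊆ ⋃ ν ∈ T, ev ν := by
    rintro w ⟨σ, hne, hle⟩
    simp only [Set.mem_iUnion, hT, Finset.mem_filter, Finset.mem_univ, true_and, exists_prop]
    exact ⟨fun _ => σ, fun h => hne (congrFun h 0), hle⟩
  calc (noiseLaw n p).real (lastFailure ρ a s) ≤ (noiseLaw n p).real (⋃ ν ∈ T, ev ν) :=
        measureReal_mono hsub (measure_ne_top _ _)
    _ ≤ ∑ ν ∈ T, (noiseLaw n p).real (ev ν) := measureReal_biUnion_finset_le _ _
    _ ≤ ∑ ν ∈ T, nodeBound n q ρ k ^ ∑ j, hammingDist ⇑(ν j) ⇑(1 : NodePerm n) := by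
        refine Finset.sum_le_sum fun ν _ => measure_score_le_nodeBound_pow hn h0 h1
          (by push_cast; exact hk) ha s (lastTuple q (ν 0)) ?_
        -- Of all ordered pairs, only those joining one of the first `q` graphs to the last are
        -- kept; each contributes the distance of the last permutation from the identity.
        rw [Fin.sum_univ_castSucc (n := q)]
        refine le_trans ?_ (Nat.le_add_right _ _)
        simp_rw [Fin.sum_univ_castSucc (n := q)]
        rw [Finset.sum_add_distrib]
        refine le_trans ?_ (Nat.le_add_left _ _)
        simp [lastTuple, hammingDist_comm]
    _ ≤ _ := by
        have := sum_tuple_pow_hammingDist_le (n := n) (q := 1) (x := nodeBound n q ρ k)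
          (Real.exp_pos _).le (by simpa using hx)
        simpa using this

/-! ### From failure events to the error of a two-stage output -/

theorem err_nonneg {n p : ℕ} (π s : Fin p → NodePerm n) : 0 ≤ err π s :=
  Real.iInf_nonneg fun _ => mul_nonneg (by positivity)
    (Finset.sum_nonneg fun _ _ => Finset.sum_nonneg fun _ _ => by split_ifs <;> norm_num)

theorem err_le {n p : ℕ} (hn : 0 < n) (hp : 0 < p) (π s : Fin p → NodePerm n)
    (φ : NodePerm n) : err π s ≤ 1 / (p : ℝ) * ∑ j, if π j = φ * s j then 0 else 1 := by
  have hn' : (0 : ℝ) < n := by exact_mod_cast hn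
  have hp' : (0 : ℝ) < p := by exact_mod_cast hp
  refine (ciInf_le (Set.finite_range _).bddBelow φ⁻¹).trans ?_
  rw [Finset.sum_comm]
  have h : ∀ j, (∑ u : Fin n, if φ⁻¹ (π j u) ≠ s j u then (1 : ℝ) else 0) ≤
      n * if π j = φ * s j then 0 else 1 := by
    intro j
    split_ifs with h
    · simp [h]
    · calc (∑ u : Fin n, if φ⁻¹ (π j u) ≠ s j u then (1 : ℝ) else 0) ≤ ∑ _u : Fin n, 1 :=
            Finset.sum_le_sum fun u _ => by split_ifs <;> norm_num
        _ = _ := by simp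
  calc _ ≤ 1 / ((n : ℝ) * p) * ∑ j, n * (if π j = φ * s j then (0 : ℝ) else 1) :=
        mul_le_mul_of_nonneg_left (Finset.sum_le_sum fun j _ => h j) (by positivity)
    _ = _ := by rw [← Finset.mul_sum]; field_simp

theorem err_le_one {n p : ℕ} (hn : 0 < n) (hp : 0 < p) (π s : Fin p → NodePerm n) :
    err π s ≤ 1 := by
  have hp' : (0 : ℝ) < p := by exact_mod_cast hp
  refine (err_le hn hp π s 1).trans ?_
  calc 1 / (p : ℝ) * ∑ j, (if π j = 1 * s j then (0 : ℝ) else 1) ≤ 1 / (p : ℝ) * ∑ _j : Fin p, 1 :=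
        mul_le_mul_of_nonneg_left
          (Finset.sum_le_sum fun j _ => by split_ifs <;> norm_num) (by positivity)
    _ = 1 := by simp [hp'.ne']

/-- Rescaling one of two graphs does not change which relabelling of the other has larger score. -/
theorem sum_smul_add_sq_le {n : ℕ} {c : ℝ} (hc : 0 ≤ c) (A g : WGraph n)
    (σ τ : Equiv.Perm (Edge n))
    (h : ∑ e, (A e + g (σ.symm e)) ^ 2 ≤ ∑ e, (A e + g (τ.symm e)) ^ 2) :
    ∑ e, (c * A e + g (σ.symm e)) ^ 2 ≤ ∑ e, (c * A e + g (τ.symm e)) ^ 2 := by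
  -- Only the cross term depends on the relabelling, and it is linear in `b`.
  have key : ∀ (b : ℝ) (σ : Equiv.Perm (Edge n)), ∑ e, (b * A e + g (σ.symm e)) ^ 2 =
      b ^ 2 * ∑ e, A e ^ 2 + ∑ e, g e ^ 2 + 2 * b * ∑ e, A e * g (σ.symm e) := by
    intro b σ
    rw [← Equiv.sum_comp σ.symm fun e => g e ^ 2, Finset.mul_sum, Finset.mul_sum,
      ← Finset.sum_add_distrib, ← Finset.sum_add_distrib]
    exact Finset.sum_congr rfl fun e _ => by ring
  have h1 := key 1 σ
  have h2 := key 1 τ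
  simp only [one_mul] at h1 h2
  rw [h1, h2] at h
  rw [key, key]
  nlinarith

/-- The first `q` graphs, followed by the graph `j`. -/
def appendIndex {p q : ℕ} (hp : q ≤ p) (j : Fin p) : Fin (q + 1) → Fin p :=
  Fin.snoc (α := fun _ => Fin p) (Fin.castLE hp) j

theorem appendIndex_injective {p q : ℕ} (hp : q ≤ p) {j : Fin p} (hj : q ≤ j) :
    Function.Injective (appendIndex hp j) := by
  intro x y
  refine Fin.lastCases ?_ (fun x' => ?_) x <;> refine Fin.lastCases ?_ (fun y' => ?_) y <;>
    simp only [appendIndex, Fin.snoc_last, Fin.snoc_castSucc]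
  · simp
  · intro h
    have := congrArg Fin.val h
    simp only [Fin.val_castLE] at this
    omega
  · intro h
    have := congrArg Fin.val h
    simp only [Fin.val_castLE] at this
    omega
  · intro h
    rw [Fin.castLE_injective hp h]

theorem score_pair {n : ℕ} (A g : WGraph n) (σ : NodePerm n) :
    score ![A, g] ![1, σ] = ∑ e, (A e + g ((edgePerm σ).symm e)) ^ 2 := by
  simp only [score, Fin.sum_univ_two, Matrix.cons_val_zero, Matrix.cons_val_one]
  refine Finset.sum_congr rfl fun e _ => ?_
  have : (edgePerm (1 : NodePerm n)).symm e = e := by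
    rw [Equiv.symm_apply_eq]; ext; simp [edgePerm]
  rw [this]

theorem score_snoc {n q : ℕ} (hq : 1 ≤ q) (g : Fin (q + 1) → WGraph n)
    (π : Fin (q + 1) → NodePerm n) :
    score g π = ∑ e, (q * averageGraph (fun i : Fin q => g i.castSucc)
      (fun i => π i.castSucc) e + g (Fin.last q) ((edgePerm (π (Fin.last q))).symm e)) ^ 2 := by
  have hq' : (q : ℝ) ≠ 0 := by exact_mod_cast (by omega : q ≠ 0)
  refine Finset.sum_congr rfl fun e _ => ?_
  rw [Fin.sum_univ_castSucc, averageGraph, ← mul_assoc, mul_one_div_cancel hq', one_mul]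

/-- Multiplying the average by `q` turns the two-graph comparison into one between scores of `q + 1`
graphs. After removing the common `φ`, only the last permutation differs from the planted one. -/
theorem score_le_of_isTwoStageOutput {n p q : ℕ} (hq : 1 ≤ q) {hp : q ≤ p}
    {g : Fin p → WGraph n} {π s : Fin p → NodePerm n} (hπ : IsTwoStageOutput hp g π)
    {φ : NodePerm n} (hφ : ∀ i : Fin q, π (Fin.castLE hp i) = φ * s (Fin.castLE hp i))
    {j : Fin p} (hj : q ≤ j) :
    score (fun i => g (appendIndex hp j i)) (fun i => s (appendIndex hp j i)) ≤
      score (fun i => g (appendIndex hp j i))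
        (fun i => lastTuple q (φ⁻¹ * π j * (s j)⁻¹) i * s (appendIndex hp j i)) := by
  rw [← score_mul_left _ φ, ← score_mul_left _ φ
    (fun i => lastTuple q (φ⁻¹ * π j * (s j)⁻¹) i * s (appendIndex hp j i)),
    score_snoc hq, score_snoc hq]
  simp only [appendIndex, lastTuple, Fin.snoc_castSucc, Fin.snoc_last, one_mul, ← hφ,
    inv_mul_cancel_right, mul_inv_cancel_left]
  refine sum_smul_add_sq_le (Nat.cast_nonneg q) _ _ _ _ ?_
  have := hπ.rest j hj ![1, φ * s j]
  rwa [score_pair, score_pair] at this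

/-- Off the joint failure event, the first stage is correct up to one relabelling `φ`, read off from
graph `0`; every other graph not matching `φ` then witnesses its own failure event. -/
theorem err_le_indicator {n p q : ℕ} {ρ : ℝ} (hn : 0 < n) (hq : 1 ≤ q) {hp : q ≤ p}
    (s : Fin p → NodePerm n) (w : WGraph n × (Fin p → WGraph n)) {π : Fin p → NodePerm n}
    (hπ : IsTwoStageOutput hp (observed ρ (s, w)) π) :
    err π s ≤ (jointFailure ρ (Fin.castLE hp) s).indicator 1 w +
      1 / (p : ℝ) * ∑ j : Fin p, if q ≤ (j : ℕ) then
        (lastFailure ρ (appendIndex hp j) s).indicator 1 w else 0 := by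
  have hp0 : 0 < p := by omega
  have hnn : ∀ j : Fin p, (0 : ℝ) ≤ if q ≤ (j : ℕ) then
      (lastFailure ρ (appendIndex hp j) s).indicator 1 w else 0 := fun j => by
    split_ifs
    exacts [Set.indicator_nonneg (fun _ _ => zero_le_one) _, le_rfl]
  by_cases hw : w ∈ jointFailure ρ (Fin.castLE hp) s
  · rw [Set.indicator_of_mem hw]
    exact (err_le_one hn hp0 π s).trans (le_add_of_nonneg_right
      (mul_nonneg (by positivity) (Finset.sum_nonneg fun j _ => hnn j)))
  · rw [Set.indicator_of_notMem hw, zero_add]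
    set i₀ : Fin q := ⟨0, hq⟩
    set φ := π (Fin.castLE hp i₀) * (s (Fin.castLE hp i₀))⁻¹
    have hφ : ∀ i : Fin q, π (Fin.castLE hp i) = φ * s (Fin.castLE hp i) := by
      intro i
      by_contra hne
      refine hw ⟨fun i => π (Fin.castLE hp i) * (s (Fin.castLE hp i))⁻¹,
        fun h => hne ?_, ?_⟩
      · have h1 : π (Fin.castLE hp i) * (s (Fin.castLE hp i))⁻¹ = φ := h i i₀
        rw [← h1, inv_mul_cancel_right]
      · simpa only [inv_mul_cancel_right] using hπ.first fun i => s (Fin.castLE hp i)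
    refine (err_le hn hp0 π s φ).trans
      (mul_le_mul_of_nonneg_left (Finset.sum_le_sum fun j _ => ?_) (by positivity))
    by_cases h : π j = φ * s j
    · rw [if_pos h]; exact hnn j
    · have hj : q ≤ (j : ℕ) := by
        by_contra hj
        exact h (hφ ⟨j, by omega⟩)
      rw [if_neg h, if_pos hj, Set.indicator_of_mem]
      · rfl
      · refine ⟨φ⁻¹ * π j * (s j)⁻¹, fun h1 => h ?_, score_le_of_isTwoStageOutput hq hπ hφ hj⟩
        rw [mul_inv_eq_one] at h1
        rw [← h1, mul_inv_cancel_left]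

/-! ### Measurability and the expected error -/

theorem continuous_observed {n p : ℕ} (ρ : ℝ) (s : Fin p → NodePerm n) :
    Continuous fun w : WGraph n × (Fin p → WGraph n) => observed ρ (s, w) := by
  refine continuous_pi fun j => continuous_pi fun e => ?_
  change Continuous fun w : WGraph n × (Fin p → WGraph n) =>
    √ρ * w.1 (edgePerm (s j) e) + √(1 - ρ) * w.2 j e
  have h1 : Continuous fun w : WGraph n × (Fin p → WGraph n) => w.2 j :=
    (continuous_apply j).comp continuous_snd
  exact (((continuous_apply _).comp continuous_fst).const_mul _).add
    (((continuous_apply e).comp h1).const_mul _)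

theorem continuous_score {n q : ℕ} (π : Fin q → NodePerm n) :
    Continuous fun g : Fin q → WGraph n => score g π := by
  unfold score
  fun_prop

theorem continuous_score_observed {n p q : ℕ} (ρ : ℝ) (s : Fin p → NodePerm n) (a : Fin q → Fin p)
    (π : Fin q → NodePerm n) : Continuous fun w : WGraph n × (Fin p → WGraph n) =>
      score (fun j => observed ρ (s, w) (a j)) π :=
  (continuous_score π).comp
    (continuous_pi fun j => (continuous_apply (a j)).comp (continuous_observed ρ s))

theorem measurableSet_jointFailure {n p q : ℕ} (ρ : ℝ) (a : Fin q → Fin p)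
    (s : Fin p → NodePerm n) : MeasurableSet (jointFailure ρ a s) := by
  have : jointFailure ρ a s = ⋃ ν : Fin q → NodePerm n, ⋃ _ : ¬ ∀ i j, ν i = ν j,
      {w | score (fun j => observed ρ (s, w) (a j)) (fun j => s (a j)) ≤
        score (fun j => observed ρ (s, w) (a j)) (fun j => ν j * s (a j))} := by
    ext w
    simp only [jointFailure, Set.mem_iUnion, Set.mem_ofPred_eq, exists_prop]
  rw [this]
  exact MeasurableSet.iUnion fun ν => MeasurableSet.iUnion fun _ =>
    (isClosed_le (continuous_score_observed ρ s a _)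
      (continuous_score_observed ρ s a _)).measurableSet

theorem measurableSet_lastFailure {n p q : ℕ} (ρ : ℝ) (a : Fin (q + 1) → Fin p)
    (s : Fin p → NodePerm n) : MeasurableSet (lastFailure ρ a s) := by
  have : lastFailure ρ a s = ⋃ σ : NodePerm n, ⋃ _ : σ ≠ 1,
      {w | score (fun j => observed ρ (s, w) (a j)) (fun j => s (a j)) ≤
        score (fun j => observed ρ (s, w) (a j)) (fun j => lastTuple q σ j * s (a j))} := by
    ext w
    simp only [lastFailure, Set.mem_iUnion, Set.mem_ofPred_eq, exists_prop]
  rw [this]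
  exact MeasurableSet.iUnion fun ν => MeasurableSet.iUnion fun _ =>
    (isClosed_le (continuous_score_observed ρ s a _)
      (continuous_score_observed ρ s a _)).measurableSet

instance instIsProbabilityMeasureLatentLaw (n p : ℕ) : IsProbabilityMeasure (latentLaw n p) := by
  have : IsProbabilityMeasure (uniformOn (Set.univ : Set (Fin p → NodePerm n))) := inferInstance
  change IsProbabilityMeasure ((uniformOn Set.univ).prod (noiseLaw n p))
  infer_instance

theorem integrable_err {n p : ℕ} (hn : 0 < n) (hp : 0 < p) (ρ : ℝ)
    {est : (Fin p → WGraph n) → (Fin p → NodePerm n)} (hest : Measurable est) :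
    Integrable (fun ω => err (est (observed ρ ω)) ω.1) (latentLaw n p) := by
  have hobs : Measurable (observed ρ :
      (Fin p → NodePerm n) × WGraph n × (Fin p → WGraph n) → Fin p → WGraph n) :=
    measurable_from_prod_countable_right fun s => (continuous_observed ρ s).measurable
  have herr : Measurable fun x : (Fin p → NodePerm n) × (Fin p → NodePerm n) => err x.1 x.2 :=
    measurable_from_prod_countable_right fun _ => Measurable.of_discrete
  refine Integrable.of_bound (C := 1)
    (herr.comp ((hest.comp hobs).prodMk measurable_fst)).aestronglyMeasurable
    (Eventually.of_forall fun ω => ?_)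
  rw [Real.norm_of_nonneg (err_nonneg _ _)]
  exact err_le_one hn hp _ _

/-- The bounds hold for every fixed `s`, then Fubini averages over it. Each stage contributes a
factor 2; the weight `1 / p` absorbs the sum over later graphs. -/
theorem expectedErr_le_nodeBound {n p q : ℕ} {ρ k : ℝ} (hn : 4 ≤ n) (h0 : 0 ≤ ρ) (h1 : ρ ≤ 1)
    (hq : 1 ≤ q) (hp : q ≤ p) (hk : ρ * (q + 1) + 1 ≤ k)
    (hx : (q : ℝ) * n ^ 2 * nodeBound n q ρ k ≤ 1)
    {est : (Fin p → WGraph n) → (Fin p → NodePerm n)} (hest : Measurable est)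
    (hout : ∀ g, IsTwoStageOutput hp g (est g)) :
    expectedErr ρ est ≤ 4 * ((q : ℝ) * n ^ 2 * nodeBound n q ρ k) := by
  have hp0 : 0 < p := by omega
  have hp' : (0 : ℝ) < p := by exact_mod_cast hp0
  have hn0 : 0 < n := by omega
  have hx0 : 0 ≤ (n : ℝ) ^ 2 * nodeBound n q ρ k :=
    mul_nonneg (by positivity) (Real.exp_pos _).le
  have hq' : (1 : ℝ) ≤ q := by exact_mod_cast hq
  have hx2 : (n : ℝ) ^ 2 * nodeBound n q ρ k ≤ q * n ^ 2 * nodeBound n q ρ k := by nlinarith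
  have hJ := fun s : Fin p → NodePerm n => measure_jointFailure_le hn h0 h1
    (by nlinarith : ρ * q + 1 ≤ k) (Fin.castLE_injective hp) s hx
  have hF := fun (s : Fin p → NodePerm n) (j : Fin p) (hj : q ≤ j) =>
    measure_lastFailure_le hn h0 h1 hk (appendIndex_injective hp hj) s (hx2.trans hx)
  have hinner : ∀ s : Fin p → NodePerm n,
      ∫ w, err (est (observed ρ (s, w))) s ∂(noiseLaw n p) ≤
        4 * ((q : ℝ) * n ^ 2 * nodeBound n q ρ k) := by
    intro s
    have hiJ : Integrable ((jointFailure ρ (Fin.castLE hp) s).indicator (1 : WGraph n × (Fin p → WGraph n) → ℝ))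
        (noiseLaw n p) :=
      (integrable_const (1 : ℝ)).indicator (measurableSet_jointFailure _ _ _)
    have hiF : ∀ j : Fin p, Integrable (fun w => if q ≤ (j : ℕ) then
        (lastFailure ρ (appendIndex hp j) s).indicator (1 : WGraph n × (Fin p → WGraph n) → ℝ) w else 0)
        (noiseLaw n p) := by
      intro j
      split_ifs
      · exact (integrable_const (1 : ℝ)).indicator (measurableSet_lastFailure _ _ _)
      · exact integrable_zero _ _ _
    have hiS := integrable_finsetSum Finset.univ fun j _ => hiF j
    refine (integral_mono_of_nonneg (Eventually.of_forall fun w => err_nonneg _ _)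
      (hiJ.add (hiS.const_mul (1 / (p : ℝ)))) (Eventually.of_forall fun w =>
        err_le_indicator hn0 hq s w (hout _))).trans ?_
    rw [integral_add' hiJ (hiS.const_mul _), integral_const_mul,
      integral_finsetSum _ fun j _ => hiF j, integral_indicator_one
        (measurableSet_jointFailure _ _ _)]
    have hsum : ∑ j : Fin p, ∫ w, (if q ≤ (j : ℕ) then
        (lastFailure ρ (appendIndex hp j) s).indicator (1 : WGraph n × (Fin p → WGraph n) → ℝ) w else 0)
        ∂(noiseLaw n p) ≤ ∑ _j : Fin p, 2 * ((n : ℝ) ^ 2 * nodeBound n q ρ k) := by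
      refine Finset.sum_le_sum fun j _ => ?_
      by_cases hj : q ≤ (j : ℕ)
      · simp only [if_pos hj]
        rw [integral_indicator_one (measurableSet_lastFailure _ _ _)]
        exact hF s j hj
      · simp only [if_neg hj, integral_zero]
        linarith
    have h2 := mul_le_mul_of_nonneg_left hsum (by positivity : 0 ≤ 1 / (p : ℝ))
    have h3 : 1 / (p : ℝ) * ∑ _j : Fin p, 2 * ((n : ℝ) ^ 2 * nodeBound n q ρ k) =
        2 * ((n : ℝ) ^ 2 * nodeBound n q ρ k) := by
      rw [Finset.sum_const, Finset.card_univ, Fintype.card_fin, nsmul_eq_mul]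
      field_simp
    linarith [hJ s]
  have hint := integrable_err hn0 hp0 ρ hest
  change ∫ ω, err (est (observed ρ ω)) ω.1 ∂((uniformOn Set.univ).prod (noiseLaw n p)) ≤ _
  change Integrable _ ((uniformOn Set.univ).prod (noiseLaw n p)) at hint
  rw [integral_prod _ hint]
  calc _ ≤ ∫ _s : Fin p → NodePerm n, 4 * ((q : ℝ) * n ^ 2 * nodeBound n q ρ k)
        ∂(uniformOn Set.univ) := integral_mono hint.integral_prod_left (integrable_const _) hinner
    _ = _ := by simp

/-! ### Constants and the exponential rate -/

/-- The rate in the exponent of the probability bound for one misplaced node. -/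
def errorRate (C : ℝ) : ℝ := C / (256 * (C + 3) ^ 2)

theorem errorRate_pos {C : ℝ} (hC : 0 < C) : 0 < errorRate C := by
  unfold errorRate; positivity

theorem log_le_of_inRegime {C c₁ : ℝ} {n p : ℕ} {ρ : ℝ} (hn : 4 ≤ n) (hc₁ : 0 ≤ c₁)
    (h : InRegime C c₁ n p ρ) : c₁ * Real.log n ≤ n * ρ := by
  obtain ⟨-, -, -, h3, -⟩ := h
  have hn' : (4 : ℝ) ≤ n := by exact_mod_cast hn
  have h4 := (mul_le_mul_of_nonneg_left (le_max_left _ _) hc₁).trans h3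
  rw [← mul_div_assoc, div_le_iff₀ (by linarith)] at h4
  linarith

theorem one_le_log {n : ℕ} (hn : 4 ≤ n) : 1 ≤ Real.log n := by
  have hn' : (4 : ℝ) ≤ n := by exact_mod_cast hn
  rw [Real.le_log_iff_exp_le (by linarith)]
  linarith [Real.exp_one_lt_three]

theorem expectedErr_le_exp {C : ℝ} (hC : 0 < C) {n p q : ℕ} {ρ : ℝ} (hn : 4 ≤ n)
    (hnC : 4 * (C + 1) ≤ n) (h : InRegime C (8 / errorRate C + 2) n p ρ)
    {est : (Fin p → WGraph n) → (Fin p → NodePerm n)} (hest : IsTwoStageEstimator C ρ q est) :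
    expectedErr ρ est ≤ Real.exp (-(errorRate C / 2) * n * ρ) := by
  have hc := errorRate_pos hC
  have hlog := log_le_of_inRegime hn (by positivity) h
  have hl1 := one_le_log hn
  have hn' : (4 : ℝ) ≤ n := by exact_mod_cast hn
  obtain ⟨-, h0, h1, -, -⟩ := h
  obtain ⟨hmeas, hq, hround, hp, hout⟩ := hest
  have hdiv : 0 ≤ 8 / errorRate C := by positivity
  have hnρ : 1 ≤ n * ρ := by nlinarith
  -- The `8 / errorRate C` part of `c₁` lets half of the exponent absorb the prefactor `n ^ 4`; the
  -- extra `2` secures `n ρ ≥ 1`.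
  have hcl : 8 * Real.log n ≤ errorRate C * (n * ρ) := by
    have h2 : 8 / errorRate C * Real.log n ≤ n * ρ := by nlinarith
    calc 8 * Real.log n = errorRate C * (8 / errorRate C * Real.log n) := by field_simp
      _ ≤ _ := mul_le_mul_of_nonneg_left h2 hc.le
  have hρ : 0 < ρ := by
    rcases h0.eq_or_lt with h2 | h2
    · rw [← h2] at hnρ; norm_num at hnρ
    · exact h2
  have hq' : (1 : ℝ) ≤ q := by exact_mod_cast hq
  rw [abs_lt] at hround
  have hCρ : ρ * (C / ρ) = C := by field_simp
  have hqu : ρ * q ≤ C + 1 := by nlinarith [hround.2]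
  -- Add `ρ q ≥ C - ρ`, from rounding, to `ρ q ≥ ρ`, from `q ≥ 1`.
  have hql : C / 2 ≤ ρ * q := by nlinarith [hround.1]
  have hqn : (q : ℝ) ≤ (C + 1) * n := by nlinarith
  have hx : nodeBound n q ρ (C + 3) ≤ Real.exp (-(errorRate C * (n * ρ))) := by
    refine Real.exp_le_exp.2 (neg_le_neg ?_)
    have h2 : ρ ^ 2 / (32 * (C + 3) ^ 2) * (n / 4 * q) =
        (n * ρ) / (128 * (C + 3) ^ 2) * (ρ * q) := by field_simp; ring
    have h3 : errorRate C * (n * ρ) = (n * ρ) / (128 * (C + 3) ^ 2) * (C / 2) := by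
      unfold errorRate; field_simp; ring
    rw [h2, h3]
    exact mul_le_mul_of_nonneg_left hql (by positivity)
  have hmain : 4 * ((q : ℝ) * n ^ 2 * nodeBound n q ρ (C + 3)) ≤
      Real.exp (-(errorRate C / 2) * n * ρ) := by
    calc 4 * ((q : ℝ) * n ^ 2 * nodeBound n q ρ (C + 3))
        ≤ (n : ℝ) ^ 4 * Real.exp (-(errorRate C * (n * ρ))) := by
          have h5 : 4 * ((q : ℝ) * n ^ 2) ≤ (n : ℝ) ^ 4 := by
            have h6 : 4 * (q : ℝ) ≤ n * n := by nlinarith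
            nlinarith [sq_nonneg (n : ℝ)]
          calc _ = 4 * ((q : ℝ) * n ^ 2) * nodeBound n q ρ (C + 3) := by ring
            _ ≤ _ := mul_le_mul h5 hx (Real.exp_pos _).le (by positivity)
      _ = Real.exp (4 * Real.log n - errorRate C * (n * ρ)) := by
          rw [sub_eq_add_neg, Real.exp_add, ← Real.exp_log (by positivity : (0 : ℝ) < n ^ 4),
            Real.log_pow]
          push_cast
          rfl
      _ ≤ _ := Real.exp_le_exp.2 (by nlinarith)
  -- `k = C + 3` works because `ρ q ≤ C + 1` and `ρ ≤ 1`.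
  refine (expectedErr_le_nodeBound hn h0 h1 hq hp (by linarith) ?_ hmeas hout).trans hmain
  have h7 : Real.exp (-(errorRate C / 2) * n * ρ) ≤ 1 := by
    rw [Real.exp_le_one_iff, neg_mul, neg_mul, neg_nonpos]
    positivity
  have h8 : 0 ≤ (q : ℝ) * n ^ 2 * nodeBound n q ρ (C + 3) :=
    mul_nonneg (by positivity) (Real.exp_pos _).le
  linarith

/-! ### Existence of measurable two-stage estimators -/

theorem exists_isTwoStageOutput {n p q : ℕ} (hp : q ≤ p) (g : Fin p → WGraph n) :
    ∃ π, IsTwoStageOutput hp g π := by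
  obtain ⟨σ, hσ⟩ := Finite.exists_max (score fun j : Fin q => g (Fin.castLE hp j))
  set A := averageGraph (fun i : Fin q => g (Fin.castLE hp i)) σ
  choose τ hτ using fun j : Fin p => Finite.exists_max fun τ => score ![A, g j] ![1, τ]
  set π : Fin p → NodePerm n := fun j => if h : (j : ℕ) < q then σ ⟨j, h⟩ else τ j with hπ
  have h1 : (fun i : Fin q => π (Fin.castLE hp i)) = σ := by
    funext i
    simp [hπ]
  refine ⟨π, by rw [h1]; exact hσ, fun j hj ζ => ?_⟩
  have h2 : π j = τ j := by simp [hπ, not_lt.2 hj]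
  -- By invariance under global relabelling, a maximizer among pairs starting with the identity is a
  -- maximizer among all pairs.
  have h3 : ζ = fun i => ζ 0 * ![1, (ζ 0)⁻¹ * ζ 1] i := by
    funext i
    fin_cases i <;> simp
  rw [h1, h2, h3, score_mul_left]
  exact hτ j _

theorem measurableSet_isTwoStageOutput {n p q : ℕ} (hp : q ≤ p) (π : Fin p → NodePerm n) :
    MeasurableSet {g | IsTwoStageOutput hp g π} := by
  have h : {g | IsTwoStageOutput hp g π} =
      (⋂ σ : Fin q → NodePerm n, {g | score (fun j => g (Fin.castLE hp j)) σ ≤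
        score (fun j => g (Fin.castLE hp j)) fun j => π (Fin.castLE hp j)}) ∩
      ⋂ j : Fin p, ⋂ _ : q ≤ (j : ℕ), ⋂ σ : Fin 2 → NodePerm n,
        {g | score ![averageGraph (fun i : Fin q => g (Fin.castLE hp i))
          (fun i : Fin q => π (Fin.castLE hp i)), g j] σ ≤
          score ![averageGraph (fun i : Fin q => g (Fin.castLE hp i))
          (fun i : Fin q => π (Fin.castLE hp i)), g j] ![1, π j]} := by
    ext g
    simp only [Set.mem_inter_iff, Set.mem_iInter, Set.mem_ofPred_eq]
    exact ⟨fun h => ⟨h.first, h.rest⟩, fun h => ⟨h.1, h.2⟩⟩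
  have h1 : Continuous fun (g : Fin p → WGraph n) (j : Fin q) => g (Fin.castLE hp j) := by
    fun_prop
  have h2 : ∀ j : Fin p, Continuous fun g : Fin p → WGraph n =>
      ![averageGraph (fun i : Fin q => g (Fin.castLE hp i))
        (fun i : Fin q => π (Fin.castLE hp i)), g j] := by
    intro j
    refine continuous_pi fun i => ?_
    fin_cases i
    · change Continuous fun g : Fin p → WGraph n => averageGraph (fun i : Fin q =>
        g (Fin.castLE hp i)) fun i : Fin q => π (Fin.castLE hp i)
      unfold averageGraph
      fun_prop
    · exact continuous_apply j
  rw [h]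
  refine MeasurableSet.inter (MeasurableSet.iInter fun σ => ?_) (MeasurableSet.iInter fun j =>
    MeasurableSet.iInter fun _ => MeasurableSet.iInter fun σ => ?_)
  · exact (isClosed_le ((continuous_score _).comp h1) ((continuous_score _).comp h1)).measurableSet
  · exact (isClosed_le ((continuous_score _).comp (h2 j))
      ((continuous_score _).comp (h2 j))).measurableSet

/-- Enumerate `A` and take the first admissible element. -/
theorem exists_measurable_selection {X A : Type*} [MeasurableSpace X] [MeasurableSpace A]
    [Countable A] [Nonempty A] {P : X → A → Prop} (hP : ∀ a, MeasurableSet {x | P x a})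
    (hex : ∀ x, ∃ a, P x a) : ∃ f : X → A, Measurable f ∧ ∀ x, P x (f x) := by
  classical
  obtain ⟨u, hu⟩ := exists_surjective_nat A
  have h : ∀ x, ∃ m, P x (u m) := fun x => by
    obtain ⟨a, ha⟩ := hex x
    obtain ⟨m, rfl⟩ := hu a
    exact ⟨m, ha⟩
  exact ⟨fun x => u (Nat.find (h x)), Measurable.find (f := fun m _ => u m)
    (fun _ => measurable_const) (fun m => hP (u m)) h, fun x => Nat.find_spec (h x)⟩

theorem exists_isTwoStageEstimator {C ρ : ℝ} {n p : ℕ} (hC : 0 < C) (hρ : 0 < ρ)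
    (hp : C / ρ < p) : ∃ (q : ℕ) (est : (Fin p → WGraph n) → (Fin p → NodePerm n)),
      IsTwoStageEstimator C ρ q est := by
  have hpos : 0 < C / ρ := div_pos hC hρ
  have hq : ⌈C / ρ⌉₊ ≤ p := Nat.ceil_le.2 hp.le
  obtain ⟨est, hmeas, hout⟩ := exists_measurable_selection
    (measurableSet_isTwoStageOutput (n := n) hq) (exists_isTwoStageOutput hq)
  refine ⟨⌈C / ρ⌉₊, est, hmeas, Nat.ceil_pos.2 hpos, ?_, hq, hout⟩
  rw [abs_of_nonneg (sub_nonneg.2 (Nat.le_ceil _))]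
  linarith [Nat.ceil_lt_add_one hpos.le]

theorem expectedErr_nonneg {n p : ℕ} (ρ : ℝ)
    (est : (Fin p → WGraph n) → (Fin p → NodePerm n)) : 0 ≤ expectedErr ρ est :=
  integral_nonneg fun _ => err_nonneg _ _

end GraphAlignment

end

/-! ### The theorem -/

open GraphAlignment in
theorem theorem2 (C : ℝ) (hC : 0 < C) :
    ∃ c₁ : ℝ, 0 < c₁ ∧ ∃ c₂ : ℝ, 0 < c₂ ∧ ∃ n₀ : ℕ,
      (∀ (n p : ℕ) (ρ : ℝ), n₀ ≤ n → GraphAlignment.InRegime C c₁ n p ρ →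
        ∀ (p' : ℕ) (est : (Fin p → GraphAlignment.WGraph n) → (Fin p → GraphAlignment.NodePerm n)),
          GraphAlignment.IsTwoStageEstimator C ρ p' est →
            GraphAlignment.expectedErr ρ est ≤ Real.exp (-c₂ * n * ρ)) ∧
      (∀ (p : ℕ → ℕ) (ρ : ℕ → ℝ),
        (∀ n, n₀ ≤ n → GraphAlignment.InRegime C c₁ n (p n) (ρ n)) →
        ∃ (p' : ℕ → ℕ)
          (est : ∀ n, (Fin (p n) → GraphAlignment.WGraph n) →
            (Fin (p n) → GraphAlignment.NodePerm n)),
          (∀ n, n₀ ≤ n → GraphAlignment.IsTwoStageEstimator C (ρ n) (p' n) (est n)) ∧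
          GraphAlignment.PartialRecovery p ρ est) := by
  have hc := errorRate_pos hC
  have hdiv : 0 ≤ 8 / errorRate C := by positivity
  set n₀ := max 4 ⌈4 * (C + 1)⌉₊ with hn₀
  have hbound : ∀ (n p : ℕ) (ρ : ℝ), n₀ ≤ n → InRegime C (8 / errorRate C + 2) n p ρ →
      ∀ (p' : ℕ) (est : (Fin p → WGraph n) → (Fin p → NodePerm n)),
        IsTwoStageEstimator C ρ p' est →
          expectedErr ρ est ≤ Real.exp (-(errorRate C / 2) * n * ρ) :=
    fun n p ρ hn h p' est hest => expectedErr_le_exp hC (le_of_max_le_left hn)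
      ((Nat.le_ceil _).trans (by exact_mod_cast le_of_max_le_right hn)) h hest
  refine ⟨8 / errorRate C + 2, by positivity, errorRate C / 2, by positivity, n₀, hbound,
    fun p ρ hreg => ?_⟩
  have hlog : ∀ n, n₀ ≤ n → Real.log n ≤ n * ρ n := fun n hn => by
    have h4 : 4 ≤ n := le_of_max_le_left hn
    have h1 := log_le_of_inRegime h4 (by positivity) (hreg n hn)
    nlinarith [one_le_log h4]
  have hex : ∀ n, ∃ (q : ℕ) (est : (Fin (p n) → WGraph n) → (Fin (p n) → NodePerm n)),
      Measurable est ∧ (n₀ ≤ n → IsTwoStageEstimator C (ρ n) q est) := by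
    intro n
    by_cases hn : n₀ ≤ n
    · have h1 := hlog n hn
      have h2 := one_le_log (le_of_max_le_left hn : 4 ≤ n)
      have hρ : 0 < ρ n := pos_of_mul_pos_right (by linarith) (Nat.cast_nonneg n)
      obtain ⟨q, est, h⟩ := exists_isTwoStageEstimator (n := n) hC hρ (hreg n hn).2.2.2.2
      exact ⟨q, est, h.measurable, fun _ => h⟩
    -- Below `n₀` any measurable map will do; the constant one is the default.
    · exact ⟨0, fun _ => 1, measurable_const, fun h => absurd h hn⟩
  choose q est hmeas hest using hex
  refine ⟨q, est, hest, hmeas, ?_⟩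
  -- Since `n ρ ≥ log n`, the error is at most the power `n ^ (-errorRate C / 2)`.
  have hlim : Tendsto (fun n : ℕ => Real.exp (-(errorRate C / 2 * Real.log n))) atTop (𝓝 0) :=
    Real.tendsto_exp_neg_atTop_nhds_zero.comp
      ((Real.tendsto_log_atTop.comp tendsto_natCast_atTop_atTop).const_mul_atTop (by positivity))
  refine tendsto_of_tendsto_of_tendsto_of_le_of_le' tendsto_const_nhds hlim
    (Eventually.of_forall fun n => expectedErr_nonneg _ _) ?_
  filter_upwards [eventually_ge_atTop n₀] with n hn
  refine (hbound n _ _ hn (hreg n hn) _ _ (hest n hn)).trans (Real.exp_le_exp.2 ?_)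
  nlinarith [hlog n hn]
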